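/- Let $\mathbb N=\{1,2,\dots\}$. A family $\mathcal A$ of subsets of a set $X$ with a distance function $d$ is *uniformly bounded* if the diameters of its members are bounded by a common constant, and *$r$-disjoint* if $d(A_1,A_2)\ge r$ for all distinct $A_1,A_2\in\mathcal A$. Let $A(X,d)$ be the collection of all finite non-empty $\sigma\subset\mathbb N$ for which there are no uniformly bounded families $\mathcal V_i$ ($i\in\sigma$) such that each $\mathcal V_i$ is $i$-disjoint and $\bigcup_{i\in\sigma}\mathcal V_i$ covers $X$. For a collection $M$ of finite non-empty subsets of $\mathbb N$ and $a\in\mathbb N$ put $M^a=\{\tau\ne\emptyset \text{ finite}: a\notin\tau,\ \{a\}\cup\tau\in M\}$; define $\operatorname{Ord}M=0$ iff $M=\emptyset$, for an ordinal $\alpha>0$ let $\operatorname{Ord} M\le\alpha$ iff $\operatorname{Ord}M^a<\alpha$ for every $a\in\mathbb N$, and put $\operatorname{Ord}M=\infty$ if $\operatorname{Ord}M\le\alpha$ holds for no ordinal $\alpha$. The transfinite asymptotic dimension is $\operatorname{trasdim}(X,d)=\operatorname{Ord}A(X,d)$. For $i,k\in\mathbb N$ let $$Y_k^{(i)}=\{x\in(2^k\mathbb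 Z)^i:\ |\{l: x_l\notin 2^i\mathbb Z\}|\le k\},\qquad Y_{\omega+k}=\bigsqcup_{i\ge1}Y_k^{(i)},\qquad X_{2\omega}=\bigsqcup_{k\ge1}Y_{\omega+k}.$$ For $m\le n$ put $g(m,n)=g(n,m)=m+(m+1)+\dots+(n-1)$ (so $g(m,m)=0$). For $x\in Y_k^{(i)}$ and $y\in Y_{k'}^{(i')}$ put $$d(x,y)=\max\{d_\infty(x,y),\ g(i,i'),\ g(k,k')\},$$ where $d_\infty$ is the sup-distance in $\mathbb R^{\max(i,i')}$, the shorter vector being extended by zeros. **Theorem 1.** The metric space $(X_{2\omega},d)$ satisfies $\operatorname{trasdim}(X_{2\omega},d)=2\omega$ (that is, $\omega+\omega$). The same equality $\operatorname{trasdim}(X_{2\omega},d')=2\omega$ holds for the distance function with weighted gaps $$d'(x,y)=\max\{d_\infty(x,y),\ \max(k,k')\,g(i,i'),\ g(k,k')\}$$ (which does not satisfy the triangle inequality). -/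

import Mathlib

/-! ### The ordinal `Ord M` -/

/-- `M^σ`: the finite non-empty sets `τ` disjoint from `σ` with `σ ∪ τ ∈ M`. -/
def residualFamily {L : Type} [DecidableEq L] (M : Set (Finset L)) (σ : Finset L) : Set (Finset L) :=
  {τ | τ.Nonempty ∧ σ ∪ τ ∈ M ∧ σ ∩ τ = ∅}

/-- `OrdLE M α` is the relation `Ord M ≤ α`: either `M = ∅`, or for every `a` there is
`β a < α` with `Ord M^{a} ≤ β a`. -/
inductive OrdLE {L : Type} [DecidableEq L] : Set (Finset L) → Ordinal.{0} → Prop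
  | empty (α : Ordinal.{0}) : OrdLE ∅ α
  | step (M : Set (Finset L)) (α : Ordinal.{0}) (β : L → Ordinal.{0})
      (hlt : ∀ a, β a < α) (h : ∀ a, OrdLE (residualFamily M {a}) (β a)) : OrdLE M α

open Classical in
/-- `Ord M`: the least `α` with `Ord M ≤ α`, and `∞ = ⊤` if there is none. -/
noncomputable def borstOrd {L : Type} [DecidableEq L] (M : Set (Finset L)) : WithTop Ordinal.{0} :=
  if ∃ α, OrdLE M α then ((sInf {α | OrdLE M α} : Ordinal.{0}) : WithTop Ordinal.{0}) else ⊤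

/-! ### Transfinite asymptotic dimension

The notions are set up for an arbitrary real-valued distance function `d`; for a metric space it
is applied to the metric. -/

/-- The diameters of the members of the family are bounded by a common constant. -/
def UniformlyBdd {X : Type*} (d : X → X → ℝ) (𝒜 : Set (Set X)) : Prop :=
  ∃ C : ℝ, 0 < C ∧ ∀ A ∈ 𝒜, ∀ x ∈ A, ∀ y ∈ A, d x y ≤ C

/-- Distinct members of the family are at distance at least `r`. -/
def RDisjoint {X : Type*} (d : X → X → ℝ) (r : ℝ) (𝒜 : Set (Set X)) : Prop :=
  ∀ A ∈ 𝒜, ∀ B ∈ 𝒜, A ≠ B → ∀ x ∈ A, ∀ y ∈ B, r ≤ d x y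

/-- The collection `A(X, d)` of finite non-empty sets of positive integers. -/
def obstructions {X : Type*} (d : X → X → ℝ) : Set (Finset ℕ+) :=
  {σ | σ.Nonempty ∧ ¬ ∃ 𝒱 : ℕ+ → Set (Set X),
    (∀ i ∈ σ, UniformlyBdd d (𝒱 i) ∧ RDisjoint d ((i : ℕ) : ℝ) (𝒱 i)) ∧
    ∀ x : X, ∃ i ∈ σ, ∃ V ∈ 𝒱 i, x ∈ V}

/-- `Ord A(X, d)` for a distance function `d`. -/
noncomputable def trasdimOf {X : Type*} (d : X → X → ℝ) : WithTop Ordinal.{0} :=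
  borstOrd (obstructions d)

/-- The transfinite asymptotic dimension of a metric space. -/
noncomputable def trasdim (X : Type*) [MetricSpace X] : WithTop Ordinal.{0} :=
  trasdimOf (fun x y : X => dist x y)

/-! ### The space -/

/-- `X_k^{(i)}`: the points of `ℝ^i` with at most `k` coordinates outside `2^i ℤ`. -/
def Xpiece (k i : ℕ) : Set (Fin i → ℝ) :=
  {x | {l : Fin i | ¬ ∃ z : ℤ, x l = 2 ^ i * (z : ℝ)}.ncard ≤ k}

/-- `Y_k^{(i)} = X_k^{(i)} ∩ (2^k ℤ)^i`. -/
def Ypiece (k i : ℕ) : Set (Fin i → ℝ) :=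
  Xpiece k i ∩ {x | ∀ l, ∃ z : ℤ, x l = 2 ^ k * (z : ℝ)}

/-- `Y_{ω+k}`: the disjoint union of the `Y_k^{(i)}`, `i ≥ 1`. -/
def Yomega (k : ℕ) : Type := Σ i : ℕ+, Ypiece k i

/-- The underlying set of `X_{2ω}`: the disjoint union of the `Y_{ω+k}`, `k ≥ 1`. -/
def X2omega : Type := Σ k : ℕ+, Yomega k

/-- A vector followed by zeros. -/
noncomputable def padZero {i : ℕ} (x : Fin i → ℝ) (l : ℕ) : ℝ :=
  if h : l < i then x ⟨l, h⟩ else 0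

/-- The sup-distance in `ℝ^{max i j}` of `x ∈ ℝ^i` and `y ∈ ℝ^j`, the shorter of the two vectors
being extended by zeros. -/
noncomputable def supDist {i j : ℕ} (x : Fin i → ℝ) (y : Fin j → ℝ) : ℝ :=
  dist (fun l : Fin (max i j) => padZero x l) (fun l : Fin (max i j) => padZero y l)

/-- `m + (m+1) + ⋯ + (n-1)` for `m ≤ n` (so `0` for `m = n`), symmetric in `m` and `n`. -/
def gap (m n : ℕ) : ℕ := ∑ l ∈ Finset.Ico (min m n) (max m n), l

/-- The distance `max {d_∞(x, y), a (i + (i+1) + ⋯ + (j-1))}` of `x ∈ ℝ^i` and `y ∈ ℝ^j`, `i ≤ j`,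
on the disjoint union of the `ℝ^i`. -/
noncomputable def unionDist (a : ℕ) {i j : ℕ} (x : Fin i → ℝ) (y : Fin j → ℝ) : ℝ :=
  max (supDist x y) ((a * gap i j : ℕ) : ℝ)

namespace X2omega

/-- The index `k` of the piece `Y_{ω+k}` that contains the point. -/
def outer (p : X2omega) : ℕ := p.1

/-- The index `i` of the piece `Y_k^{(i)}` that contains the point. -/
def inner (p : X2omega) : ℕ := p.2.1

/-- The coordinates of the point. -/
def vec (p : X2omega) : Fin p.inner → ℝ := p.2.2.1

/-- The metric of `X_{2ω}`: all gaps between the `ℝ^i` have weight `1`. -/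
noncomputable def gapDist (p q : X2omega) : ℝ :=
  max (unionDist 1 p.vec q.vec) (gap p.outer q.outer : ℝ)

/-- The variant with weighted gaps: points `p` of `Y_{ω+m}` and `q` of `Y_{ω+n}`, `m ≤ n`, have
distance `max {d_n(p, q), m + (m+1) + ⋯ + (n-1)}`, where in `d_n` the gaps between the `ℝ^i`
have weight `n`. This distance function does not satisfy the triangle inequality. -/
noncomputable def weightedDist (p q : X2omega) : ℝ :=
  max (unionDist (max p.outer q.outer) p.vec q.vec) (gap p.outer q.outer : ℝ)

end X2omega

theorem supDist_le_iff {i j : ℕ} (x : Fin i → ℝ) (y : Fin j → ℝ) {r : ℝ} (hr : 0 ≤ r) :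
    supDist x y ≤ r ↔ ∀ l : ℕ, |padZero x l - padZero y l| ≤ r := by
  unfold supDist
  rw [dist_pi_le_iff hr]
  constructor
  · intro h l
    by_cases hl : l < max i j
    · exact h ⟨l, hl⟩
    · have h1 : ¬ l < i := fun h => hl (lt_of_lt_of_le h (le_max_left _ _))
      have h2 : ¬ l < j := fun h => hl (lt_of_lt_of_le h (le_max_right _ _))
      simpa [padZero, h1, h2] using hr
  · intro h l
    exact h l

theorem supDist_nonneg {i j : ℕ} (x : Fin i → ℝ) (y : Fin j → ℝ) : 0 ≤ supDist x y :=
  dist_nonneg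

theorem supDist_self {i : ℕ} (x : Fin i → ℝ) : supDist x x = 0 := dist_self _

theorem supDist_comm {i j : ℕ} (x : Fin i → ℝ) (y : Fin j → ℝ) : supDist x y = supDist y x :=
  le_antisymm
    ((supDist_le_iff x y (supDist_nonneg y x)).2 fun l => by
      rw [abs_sub_comm]; exact (supDist_le_iff y x (supDist_nonneg y x)).1 le_rfl l)
    ((supDist_le_iff y x (supDist_nonneg x y)).2 fun l => by
      rw [abs_sub_comm]; exact (supDist_le_iff x y (supDist_nonneg x y)).1 le_rfl l)

theorem supDist_triangle {i j k : ℕ} (x : Fin i → ℝ) (y : Fin j → ℝ) (z : Fin k → ℝ) :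
    supDist x z ≤ supDist x y + supDist y z := by
  have h1 := supDist_nonneg x y
  have h2 := supDist_nonneg y z
  refine (supDist_le_iff x z (by positivity)).2 fun l => ?_
  exact (abs_sub_le _ (padZero y l) _).trans
    (add_le_add ((supDist_le_iff x y h1).1 le_rfl l) ((supDist_le_iff y z h2).1 le_rfl l))

theorem eq_of_supDist_eq_zero {i : ℕ} {x y : Fin i → ℝ} (h : supDist x y ≤ 0) : x = y := by
  funext l
  have h1 := (supDist_le_iff x y le_rfl).1 h l
  simp only [padZero, l.2, dif_pos] at h1
  exact sub_eq_zero.1 (abs_nonpos_iff.1 h1)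

theorem gap_comm (m n : ℕ) : gap m n = gap n m := by
  unfold gap; rw [min_comm, max_comm]

theorem gap_self (m : ℕ) : gap m m = 0 := by simp [gap]

theorem gap_eq_abs (m n : ℕ) :
    (gap m n : ℝ) = |(∑ l ∈ Finset.range m, (l : ℝ)) - ∑ l ∈ Finset.range n, (l : ℝ)| := by
  have key : ∀ a b : ℕ, a ≤ b → (gap a b : ℝ) =
      |(∑ l ∈ Finset.range a, (l : ℝ)) - ∑ l ∈ Finset.range b, (l : ℝ)| := by
    intro a b hab
    have h := Finset.sum_Ico_eq_sub (fun l : ℕ => (l : ℝ)) hab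
    have hn : (0 : ℝ) ≤ ∑ l ∈ Finset.Ico a b, (l : ℝ) :=
      Finset.sum_nonneg fun l _ => Nat.cast_nonneg l
    rw [abs_sub_comm, ← h, abs_of_nonneg hn]
    simp [gap, min_eq_left hab, max_eq_right hab]
  rcases le_total m n with h | h
  · exact key m n h
  · rw [gap_comm, abs_sub_comm]; exact key n m h

theorem gap_triangle (m n p : ℕ) : (gap m p : ℝ) ≤ gap m n + gap n p := by
  simp only [gap_eq_abs]
  exact abs_sub_le _ _ _

theorem eq_of_gap_eq_zero {m n : ℕ} (hm : 0 < m) (hn : 0 < n) (h : gap m n = 0) : m = n := by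
  by_contra hne
  have hlt : min m n < max m n := by omega
  have h1 := (Finset.sum_eq_zero_iff.1 h) (min m n) (Finset.mem_Ico.2 ⟨le_rfl, hlt⟩)
  omega

namespace X2omega

theorem gapDist_triangle (p q r : X2omega) : gapDist p r ≤ gapDist p q + gapDist q r := by
  have hs := supDist_triangle p.vec q.vec r.vec
  have hi := gap_triangle p.inner q.inner r.inner
  have ho := gap_triangle p.outer q.outer r.outer
  simp only [gapDist, unionDist, one_mul]
  refine max_le (max_le (hs.trans (add_le_add ?_ ?_)) (hi.trans (add_le_add ?_ ?_)))
    (ho.trans (add_le_add ?_ ?_))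
  all_goals simp

theorem eq_of_gapDist_eq_zero {p q : X2omega} (h : gapDist p q = 0) : p = q := by
  have h' := h.le
  simp only [gapDist, unionDist, one_mul, max_le_iff] at h'
  obtain ⟨⟨hs, hi⟩, ho⟩ := h'
  have ho' : p.outer = q.outer := eq_of_gap_eq_zero p.1.pos q.1.pos
    (by exact_mod_cast le_antisymm ho (Nat.cast_nonneg _))
  have hi' : p.inner = q.inner := eq_of_gap_eq_zero p.2.1.pos q.2.1.pos
    (by exact_mod_cast le_antisymm hi (Nat.cast_nonneg _))
  obtain ⟨k, i, x⟩ := p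
  obtain ⟨k', i', y⟩ := q
  obtain rfl : k = k' := PNat.coe_injective ho'
  obtain rfl : i = i' := PNat.coe_injective hi'
  obtain rfl : x = y := Subtype.ext (eq_of_supDist_eq_zero hs)
  rfl

noncomputable instance : MetricSpace X2omega where
  dist := gapDist
  dist_self p := by simp [gapDist, unionDist, supDist_self, gap_self]
  dist_comm p q := by
    simp only [gapDist, unionDist, supDist_comm p.vec, gap_comm p.inner, gap_comm p.outer]
  dist_triangle := gapDist_triangle
  eq_of_dist_eq_zero := eq_of_gapDist_eq_zero

end X2omega

/-! ### Bounds on `Ord M` through cardinalities of residual families -/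

section OrdLE

variable {L : Type} [DecidableEq L]

/-! Unwinding the ordinal (`borstOrd_eq_omega0_add_omega0`), two things are needed. Upper bound: for
each `a` some number `m` of further elements makes the residual family bounded in cardinality. Lower
bound: there are arbitrarily large `σ` whose residual family is unbounded.

Upper bound, with `m = a`. One `a`-disjoint family handles all points with `k ≥ a`, where
coordinates lie in `2^k ℤ`. For `k < a` and large `i`, fewer than `a` coordinates are off the
lattice `2^i ℤ`, so `a` families of boxes suffice, at a scale dictated by `σ` (`exists_inBox`). What
is left has bounded `i` and `k`, hence bounded dimension, and is covered at any scale by a fixed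
number of families, so a large `τ` cannot be an obstruction.

Lower bound. After rescaling, `Y_k^{(k+n)}` is the set of fine-grid vertices in the `k`-skeleton of
a grid coarser by the factor `2^n`. A Lebesgue-type covering argument with mod 2 cubical cycles
shows that `n` coarsely separated and `k` finely separated bounded families miss such a vertex: each
family cuts the current cycle in a new direction, along a boundary avoiding the family. The coarse
cuts push the cycle into the `k`-skeleton, the fine cuts reduce it to points, and its odd degree
keeps it nonzero (`IsSliceCycle.cut`, `exists_uncovered_vertex`).

Both distances enter only through `IsGapDist`, except in the family for `k ≥ a`. -/

theorem OrdLE.mono {M : Set (Finset L)} {α β : Ordinal.{0}} (h : OrdLE M α) (hαβ : α ≤ β) :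
    OrdLE M β := by
  cases h with
  | empty => exact .empty β
  | step _ _ γ hlt h => exact .step M β γ (fun a => (hlt a).trans_le hαβ) h

theorem OrdLE.residualFamily_lt {M : Set (Finset L)} {α : Ordinal.{0}} (h : OrdLE M α)
    (hα : 0 < α) (a : L) : ∃ β < α, OrdLE (residualFamily M {a}) β := by
  cases h with
  | empty =>
    refine ⟨0, hα, ?_⟩
    have : residualFamily (∅ : Set (Finset L)) {a} = ∅ := by
      ext τ; simp [residualFamily]
    rw [this]; exact .empty 0
  | step _ _ γ hlt h => exact ⟨γ a, hlt a, h a⟩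

theorem residualFamily_residualFamily {M : Set (Finset L)} {a : L} {σ : Finset L} (ha : a ∉ σ) :
    residualFamily (residualFamily M {a}) σ = residualFamily M (insert a σ) := by
  ext τ
  simp only [residualFamily, Set.mem_ofPred_eq, ← Finset.disjoint_iff_inter_eq_empty,
    Finset.disjoint_singleton_left, Finset.mem_union, not_or,
    Finset.insert_eq, Finset.union_assoc, Finset.disjoint_union_left]
  constructor
  · rintro ⟨h1, ⟨-, h2, -, h3⟩, h4⟩
    exact ⟨h1, h2, h3, h4⟩
  · rintro ⟨h1, h2, h3, h4⟩
    exact ⟨h1, ⟨h1.mono Finset.subset_union_right, h2, ha, h3⟩, h4⟩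

theorem OrdLE.card_le {n : ℕ} : ∀ {M : Set (Finset L)}, OrdLE M (n : Ordinal.{0}) →
    ∀ {τ : Finset L}, τ ∈ M → τ.card ≤ n := by
  induction n using Nat.strong_induction_on with
  | _ n ih =>
    intro M h τ hτ
    rcases τ.eq_empty_or_nonempty with rfl | ⟨a, ha⟩
    · simp
    rcases Nat.eq_zero_or_pos n with rfl | hn
    · cases h with
      | empty => exact hτ.elim
      | step _ _ γ hlt h =>
        have := hlt a
        simp at this
    obtain ⟨β, hβ, hM⟩ := h.residualFamily_lt (by exact_mod_cast hn) a
    obtain ⟨m, rfl⟩ := Ordinal.lt_omega0.1 (hβ.trans (Ordinal.natCast_lt_omega0 n))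
    have hmn : m < n := by exact_mod_cast hβ
    have hc := Finset.card_erase_add_one ha
    -- Residual families contain only non-empty sets, so singletons need a separate argument.
    rcases (τ.erase a).eq_empty_or_nonempty with he | he
    · rw [he] at hc
      simp at hc
      omega
    · have := ih m hmn hM (τ := τ.erase a) ⟨he, by
        rwa [← Finset.insert_eq, Finset.insert_erase ha], by
        simp⟩
      omega

theorem OrdLE.of_card_le {n : ℕ} : ∀ {M : Set (Finset L)},
    (∀ τ ∈ M, τ.Nonempty ∧ τ.card ≤ n) → OrdLE M (n : Ordinal.{0}) := by
  induction n with
  | zero =>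
    intro M h
    have : M = ∅ := by
      ext τ
      simp only [Set.mem_empty_iff_false, iff_false]
      intro hτ
      have := h τ hτ
      have := this.1.card_pos
      omega
    rw [this]; exact .empty _
  | succ n ih =>
    intro M h
    refine .step M _ (fun _ => n) (fun _ => by exact_mod_cast Nat.lt_succ_self n) fun a => ih ?_
    rintro τ ⟨h1, h2, h3⟩
    refine ⟨h1, ?_⟩
    have h4 := (h _ h2).2
    rw [Finset.card_union_of_disjoint (Finset.disjoint_iff_inter_eq_empty.2 h3)] at h4
    simp at h4
    omega

/-- Each removed element lowers the ordinal strictly: `j` of them bring `ω + j` down to `ω`, and one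
more makes it finite. Hence the `j + 1`. -/
theorem OrdLE.residualFamily_card_le {j : ℕ} : ∀ {M : Set (Finset L)},
    OrdLE M (Ordinal.omega0 + (j : Ordinal.{0})) → ∀ {σ : Finset L}, σ.card = j + 1 →
    ∃ n : ℕ, ∀ τ ∈ residualFamily M σ, τ.card ≤ n := by
  induction j with
  | zero =>
    intro M h σ hσ
    obtain ⟨a, rfl⟩ := Finset.card_eq_one.1 hσ
    obtain ⟨β, hβ, hM⟩ := h.residualFamily_lt (by simp [Ordinal.omega0_pos]) a
    rw [Nat.cast_zero, add_zero] at hβ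
    obtain ⟨m, rfl⟩ := Ordinal.lt_omega0.1 hβ
    exact ⟨m, fun τ hτ => hM.card_le hτ⟩
  | succ j ih =>
    intro M h σ hσ
    obtain ⟨a, σ, ha, rfl, hc⟩ := Finset.card_eq_succ.1 hσ
    obtain ⟨β, hβ, hM⟩ := h.residualFamily_lt
      (Ordinal.omega0_pos.trans_le le_self_add) a
    rw [Nat.cast_succ, ← add_assoc, Order.lt_add_one_iff] at hβ
    rw [← residualFamily_residualFamily ha]
    exact ih (hM.mono hβ) hc

theorem OrdLE.of_residualFamily_card_le {m : ℕ} : ∀ {M : Set (Finset L)},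
    (∀ σ : Finset L, σ.card = m → ∃ n : ℕ, ∀ τ ∈ residualFamily M σ, τ.card ≤ n) →
    (∀ τ ∈ M, τ.Nonempty) → OrdLE M (Ordinal.omega0 + (m : Ordinal.{0})) := by
  induction m with
  | zero =>
    intro M h hne
    obtain ⟨n, hn⟩ := h ∅ rfl
    refine (OrdLE.of_card_le (n := n) fun τ hτ => ⟨hne τ hτ, hn τ ⟨hne τ hτ, ?_, ?_⟩⟩).mono ?_
    · simpa using hτ
    · simp
    · simpa using (Ordinal.natCast_lt_omega0 n).le
  | succ m ih =>
    intro M h hne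
    refine .step M _ (fun _ => Ordinal.omega0 + m) (fun _ => ?_) fun a => ih ?_ fun τ hτ => hτ.1
    · rw [Nat.cast_succ, ← add_assoc, Order.lt_add_one_iff]
    · intro σ hσ
      by_cases ha : a ∈ σ
      · refine ⟨0, fun τ hτ => ?_⟩
        have := hτ.2.1.2.2
        rw [← Finset.disjoint_iff_inter_eq_empty] at this
        simp [ha] at this
      · rw [residualFamily_residualFamily ha]
        exact h _ (by rw [Finset.card_insert_of_notMem ha, hσ])

theorem exists_nat_of_lt_omega0_add_omega0 {α : Ordinal.{0}}
    (h : α < Ordinal.omega0 + Ordinal.omega0) : ∃ j : ℕ, α ≤ Ordinal.omega0 + j := by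
  -- Otherwise `α` is at least `ω`, and `α - ω` exceeds every natural number.
  by_contra! hc
  refine absurd h (not_lt.2 ?_)
  rcases le_total Ordinal.omega0 α with hα | hα
  · rw [← Ordinal.add_sub_cancel_of_le hα]
    refine add_le_add_right (not_lt.1 fun hlt => ?_) _
    obtain ⟨n, hn⟩ := Ordinal.lt_omega0.1 hlt
    have := hc n
    rw [← hn, Ordinal.add_sub_cancel_of_le hα] at this
    exact lt_irrefl _ this
  · exact absurd (hc 0) (not_lt.2 (by simpa using hα))

theorem borstOrd_eq_omega0_add_omega0 {M : Set (Finset L)}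
    (hupper : ∀ a : L, ∃ m : ℕ, ∀ σ : Finset L, a ∉ σ → σ.card = m →
      ∃ n : ℕ, ∀ τ ∈ residualFamily M (insert a σ), τ.card ≤ n)
    (hlower : ∀ k : ℕ, ∃ σ : Finset L, σ.card = k + 1 ∧
      ∀ n : ℕ, ∃ τ ∈ residualFamily M σ, n < τ.card) :
    borstOrd M = ((Ordinal.omega0 + Ordinal.omega0 : Ordinal.{0}) : WithTop Ordinal.{0}) := by
  have hle : OrdLE M (Ordinal.omega0 + Ordinal.omega0) := by
    choose m hm using hupper
    refine .step M _ (fun a => Ordinal.omega0 + m a) (fun a => ?_) fun a =>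
      OrdLE.of_residualFamily_card_le (fun σ hσ => ?_) fun τ hτ => hτ.1
    · exact (add_lt_add_iff_left _).2 (Ordinal.natCast_lt_omega0 _)
    · by_cases ha : a ∈ σ
      · refine ⟨0, fun τ hτ => ?_⟩
        have := hτ.2.1.2.2
        rw [← Finset.disjoint_iff_inter_eq_empty] at this
        simp [ha] at this
      · rw [residualFamily_residualFamily ha]
        exact hm a σ ha hσ
  have hge : ∀ α, OrdLE M α → Ordinal.omega0 + Ordinal.omega0 ≤ α := by
    intro α h
    by_contra! hlt
    obtain ⟨j, hj⟩ := exists_nat_of_lt_omega0_add_omega0 hlt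
    obtain ⟨σ, hσ, hτ⟩ := hlower j
    obtain ⟨n, hn⟩ := (h.mono hj).residualFamily_card_le hσ
    obtain ⟨τ, h1, h2⟩ := hτ n
    exact absurd (hn τ h1) (not_le.2 h2)
  rw [borstOrd, if_pos ⟨_, hle⟩]
  exact congrArg _ (le_antisymm (csInf_le' hle) (le_csInf ⟨_, hle⟩ hge))

end OrdLE

/-! ### Coverings by periodic families of boxes -/

section Boxes

/-- The index, in direction `l`, of the box of the `j`-th family of boxes containing `v`. -/
noncomputable def boxIndex (s P : ℝ) (j : ℕ) (v : ℕ → ℝ) (l : ℕ) : ℤ :=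
  ⌊(v l - (j + 1) * s) / P⌋

/-- `v` lies in a box of the `j`-th family: products of the intervals
`[(j + 1) s + m P, j s + (m + 1) P]`. -/
def InBox (s P : ℝ) (j : ℕ) (v : ℕ → ℝ) : Prop :=
  ∀ l, v l - (j + 1) * s - boxIndex s P j v l * P ≤ P - s

theorem boxIndex_bounds {s P : ℝ} (hP : 0 < P) (j : ℕ) (v : ℕ → ℝ) (l : ℕ) :
    0 ≤ v l - (j + 1) * s - boxIndex s P j v l * P ∧
      v l - (j + 1) * s - boxIndex s P j v l * P < P := by
  have h1 := Int.floor_le ((v l - (j + 1) * s) / P)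
  have h2 := Int.lt_floor_add_one ((v l - (j + 1) * s) / P)
  rw [le_div_iff₀ hP] at h1
  rw [div_lt_iff₀ hP] at h2
  simp only [boxIndex]
  constructor <;> linarith

theorem le_abs_sub_of_boxIndex_lt {s P : ℝ} (hP : 0 < P) {j : ℕ} {v w : ℕ → ℝ}
    (hv : InBox s P j v) {l : ℕ} (h : boxIndex s P j v l < boxIndex s P j w l) :
    s ≤ |v l - w l| := by
  have h1 := hv l
  have h2 := (boxIndex_bounds (s := s) hP j w l).1
  have h3 : (boxIndex s P j v l : ℝ) + 1 ≤ boxIndex s P j w l := by exact_mod_cast h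
  have h4 := mul_le_mul_of_nonneg_right h3 hP.le
  rw [abs_sub_comm]
  exact le_trans (by linarith) (le_abs_self _)

theorem exists_le_abs_sub_of_boxIndex_ne {s P : ℝ} (hP : 0 < P) {j : ℕ} {v w : ℕ → ℝ}
    (hv : InBox s P j v) (hw : InBox s P j w) (h : boxIndex s P j v ≠ boxIndex s P j w) :
    ∃ l, s ≤ |v l - w l| := by
  obtain ⟨l, hl⟩ := Function.ne_iff.1 h
  refine ⟨l, ?_⟩
  rcases lt_or_gt_of_ne hl with hl | hl
  · exact le_abs_sub_of_boxIndex_lt hP hv hl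
  · rw [abs_sub_comm]; exact le_abs_sub_of_boxIndex_lt hP hw hl

theorem abs_sub_le_of_boxIndex_eq {s P : ℝ} (hP : 0 < P) {j : ℕ} {v w : ℕ → ℝ}
    (h : boxIndex s P j v = boxIndex s P j w) (l : ℕ) : |v l - w l| ≤ P := by
  have h1 := boxIndex_bounds (s := s) hP j v l
  have h2 := boxIndex_bounds (s := s) hP j w l
  rw [h] at h1
  rw [abs_le]
  constructor <;> linarith

/-- Pigeonhole: modulo `P` the `j`-th family omits only the open strip `(j s, (j + 1) s)` in each
direction. These strips are disjoint and avoid `0`, so a coordinate outside `B` spoils no `j`, and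
one in `B` spoils at most one. -/
theorem exists_inBox {s P : ℝ} (hs : 0 < s) {N : ℕ} (hN : N * s ≤ P) {v : ℕ → ℝ}
    (B : Finset ℕ) (hB : ∀ l, l ∉ B → ∃ z : ℤ, v l = P * z) (hcard : B.card < N) :
    ∃ j < N, InBox s P j v := by
  have hP : 0 < P := by
    refine lt_of_lt_of_le ?_ hN
    have : (0 : ℝ) < N := by exact_mod_cast (Nat.zero_le _).trans_lt hcard
    positivity
  set u : ℕ → ℝ := fun l => v l - ⌊v l / P⌋ * P with hu
  have hu0 : ∀ l, 0 ≤ u l ∧ u l < P := by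
    intro l
    have h1 := Int.floor_le (v l / P)
    have h2 := Int.lt_floor_add_one (v l / P)
    rw [le_div_iff₀ hP] at h1
    rw [div_lt_iff₀ hP] at h2
    simp only [hu]
    constructor <;> linarith
  have huB : ∀ l, l ∉ B → u l = 0 := by
    intro l hl
    obtain ⟨z, hz⟩ := hB l hl
    simp only [hu, hz, mul_div_cancel_left₀ _ hP.ne', Int.floor_intCast]
    ring
  have : ∃ j ∈ Finset.range N, j ∉ B.image fun l => ⌊u l / s⌋₊ := by
    by_contra! h
    have := Finset.card_le_card (s := Finset.range N) h
    rw [Finset.card_range] at this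
    exact absurd (this.trans Finset.card_image_le) (not_le.2 hcard)
  obtain ⟨j, hjN, hj⟩ := this
  refine ⟨j, Finset.mem_range.1 hjN, fun l => ?_⟩
  have hj1 : ((j : ℝ) + 1) * s ≤ P := by
    refine le_trans (mul_le_mul_of_nonneg_right ?_ hs.le) hN
    exact_mod_cast Finset.mem_range.1 hjN
  have hjs : (0 : ℝ) ≤ (j + 1) * s := by positivity
  have hv : v l = u l + ⌊v l / P⌋ * P := by simp [hu]
  rcases le_or_gt ((j + 1) * s) (u l) with h | h
  · have : boxIndex s P j v l = ⌊v l / P⌋ := by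
      rw [boxIndex, Int.floor_eq_iff, le_div_iff₀ hP, div_lt_iff₀ hP]
      constructor <;> linarith [(hu0 l).2]
    rw [this]
    have : s ≤ (j + 1) * s := by nlinarith [(Nat.cast_nonneg j : (0 : ℝ) ≤ j)]
    linarith [(hu0 l).2]
  · have h' : u l ≤ j * s := by
      by_contra! hlt
      by_cases hl : l ∈ B
      · refine hj (Finset.mem_image.2 ⟨l, hl, ?_⟩)
        rw [Nat.floor_eq_iff (div_nonneg (hu0 l).1 hs.le), le_div_iff₀ hs, div_lt_iff₀ hs]
        exact ⟨hlt.le, h⟩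
      · rw [huB l hl] at hlt
        have : (0 : ℝ) ≤ j * s := by positivity
        linarith
    have : boxIndex s P j v l = ⌊v l / P⌋ - 1 := by
      rw [boxIndex, Int.floor_eq_iff, le_div_iff₀ hP, div_lt_iff₀ hP]
      push_cast
      constructor <;> linarith [(hu0 l).1]
    rw [this]
    push_cast
    linarith

end Boxes

/-! ### Gap estimates and families of fibres -/

theorem le_gap_of_lt {m n : ℕ} (h : m < n) : n - 1 ≤ gap m n := by
  rw [gap, min_eq_left h.le, max_eq_right h.le]
  exact Finset.single_le_sum (f := fun l => l) (fun _ _ => Nat.zero_le _)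
    (Finset.mem_Ico.2 (by omega))

theorem le_gap {m n a : ℕ} (h : m ≠ n) (hm : a ≤ m) (hn : a ≤ n) : a ≤ gap m n := by
  rcases lt_or_gt_of_ne h with h | h
  · exact le_trans (by omega) (le_gap_of_lt h)
  · rw [gap_comm]; exact le_trans (by omega) (le_gap_of_lt h)

theorem gap_le {m n a : ℕ} (hm : m ≤ a) (hn : n ≤ a) : gap m n ≤ ∑ l ∈ Finset.range a, l := by
  refine Finset.sum_le_sum_of_subset fun l hl => ?_
  rw [Finset.mem_Ico] at hl
  exact Finset.mem_range.2 (hl.2.trans_le (max_le hm hn))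

theorem UniformlyBdd.of_le {X : Type*} {d : X → X → ℝ} {𝒜 : Set (Set X)} {C : ℝ}
    (h : ∀ A ∈ 𝒜, ∀ x ∈ A, ∀ y ∈ A, d x y ≤ C) : UniformlyBdd d 𝒜 :=
  ⟨max C 1, by positivity, fun A hA x hx y hy => (h A hA x hx y hy).trans (le_max_left _ _)⟩

theorem RDisjoint.mono {X : Type*} {d : X → X → ℝ} {𝒜 : Set (Set X)} {r s : ℝ}
    (h : RDisjoint d s 𝒜) (hrs : r ≤ s) : RDisjoint d r 𝒜 :=
  fun A hA B hB hAB x hx y hy => hrs.trans (h A hA B hB hAB x hx y hy)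

/-- The non-empty fibres of the restriction of `f` to `D`. -/
def fibreFamily {X β : Type*} (D : Set X) (f : X → β) : Set (Set X) :=
  {A | ∃ b, A = {x | x ∈ D ∧ f x = b}}

theorem uniformlyBdd_fibreFamily {X β : Type*} {d : X → X → ℝ} {D : Set X} {f : X → β} {C : ℝ}
    (h : ∀ x ∈ D, ∀ y ∈ D, f x = f y → d x y ≤ C) : UniformlyBdd d (fibreFamily D f) := by
  refine .of_le (C := C) ?_
  rintro A ⟨b, rfl⟩ x ⟨hx, hxb⟩ y ⟨hy, hyb⟩
  exact h x hx y hy (hxb.trans hyb.symm)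

theorem rDisjoint_fibreFamily {X β : Type*} {d : X → X → ℝ} {D : Set X} {f : X → β} {r : ℝ}
    (h : ∀ x ∈ D, ∀ y ∈ D, f x ≠ f y → r ≤ d x y) : RDisjoint d r (fibreFamily D f) := by
  rintro A ⟨b, rfl⟩ B ⟨b', rfl⟩ hAB x ⟨hx, hxb⟩ y ⟨hy, hyb⟩
  refine h x hx y hy fun h => hAB ?_
  rw [← hxb, ← hyb, h]

theorem exists_mem_fibreFamily {X β : Type*} {D : Set X} (f : X → β) {x : X} (hx : x ∈ D) :
    ∃ V ∈ fibreFamily D f, x ∈ V :=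
  ⟨_, ⟨f x, rfl⟩, hx, rfl⟩

/-! ### Upper bound: covering the space -/

namespace X2omega

/-- The coordinates of the point, followed by zeros. -/
noncomputable def pad (p : X2omega) : ℕ → ℝ := padZero p.vec

/-- The distance functions on `X2omega` that are bounded below by the sup-distance and by the gaps,
and are bounded above in terms of them on the points with bounded outer index. -/
structure IsGapDist (d : X2omega → X2omega → ℝ) : Prop where
  supDist_le : ∀ p q, supDist p.vec q.vec ≤ d p q
  inner_le : ∀ p q, (gap p.inner q.inner : ℝ) ≤ d p q
  outer_le : ∀ p q, (gap p.outer q.outer : ℝ) ≤ d p q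
  le_max : ∀ (a : ℕ) p q, p.outer ≤ a → q.outer ≤ a →
    d p q ≤ max (max (supDist p.vec q.vec) ((a * gap p.inner q.inner : ℕ) : ℝ))
      (gap p.outer q.outer)

theorem outer_pos (p : X2omega) : 0 < p.outer := p.1.pos

theorem inner_pos (p : X2omega) : 0 < p.inner := p.2.1.pos

theorem isGapDist_gapDist : IsGapDist gapDist where
  supDist_le p q := (le_max_left _ _).trans (le_max_left _ _)
  inner_le p q := by
    refine le_trans ?_ ((le_max_right _ _).trans (le_max_left _ _))
    simp
  outer_le p q := le_max_right _ _
  le_max a p q hp hq := by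
    refine max_le_max (max_le_max le_rfl ?_) le_rfl
    exact_mod_cast Nat.mul_le_mul_right _ (p.outer_pos.trans_le hp)

theorem isGapDist_weightedDist : IsGapDist weightedDist where
  supDist_le p q := (le_max_left _ _).trans (le_max_left _ _)
  inner_le p q := by
    refine le_trans ?_ ((le_max_right _ _).trans (le_max_left _ _))
    exact_mod_cast Nat.le_mul_of_pos_left _ (p.outer_pos.trans_le (le_max_left _ _))
  outer_le p q := le_max_right _ _
  le_max a p q hp hq := by
    refine max_le_max (max_le_max le_rfl ?_) le_rfl
    exact_mod_cast Nat.mul_le_mul_right _ (max_le hp hq)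

variable {d : X2omega → X2omega → ℝ}

theorem abs_pad_sub_pad_le (p q : X2omega) (l : ℕ) :
    |p.pad l - q.pad l| ≤ supDist p.vec q.vec :=
  (supDist_le_iff p.vec q.vec (supDist_nonneg _ _)).1 le_rfl l

theorem pad_eq_zero {p : X2omega} {l : ℕ} (h : p.inner ≤ l) : p.pad l = 0 := by
  simp [pad, padZero, not_lt.2 h]

theorem exists_pad_eq_pow_outer (p : X2omega) (l : ℕ) : ∃ z : ℤ, p.pad l = 2 ^ p.outer * z := by
  by_cases h : l < p.inner
  · obtain ⟨z, hz⟩ := p.2.2.2.2 ⟨l, h⟩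
    refine ⟨z, ?_⟩
    simp only [pad, padZero, h, dif_pos]
    exact hz
  · exact ⟨0, by simp [pad_eq_zero (not_lt.1 h)]⟩

theorem exists_finset_pad_eq (p : X2omega) : ∃ B : Finset ℕ, B.card ≤ p.outer ∧
    ∀ l, l ∉ B → ∃ z : ℤ, p.pad l = 2 ^ p.inner * z := by
  classical
  refine ⟨(Finset.univ.filter fun l : Fin p.inner => ¬ ∃ z : ℤ, p.vec l = 2 ^ p.inner * z).map
    Fin.valEmbedding, ?_, fun l hl => ?_⟩
  · rw [Finset.card_map, ← Set.ncard_coe_finset]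
    have h : {l : Fin p.inner | ¬ ∃ z : ℤ, p.vec l = 2 ^ p.inner * z}.ncard ≤ p.outer :=
      p.2.2.2.1
    simpa using h
  · by_cases h : l < p.inner
    · simp only [pad, padZero, h, dif_pos]
      by_contra hc
      exact hl (Finset.mem_map.2 ⟨⟨l, h⟩, by simpa using hc, rfl⟩)
    · exact ⟨0, by simp [pad_eq_zero (not_lt.1 h)]⟩

theorem IsGapDist.le_of_pad_ne (hd : IsGapDist d) {p q : X2omega} (ho : p.outer = q.outer)
    (h : p.pad ≠ q.pad) : (p.outer : ℝ) ≤ d p q := by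
  obtain ⟨l, hl⟩ := Function.ne_iff.1 h
  refine le_trans ?_ ((abs_pad_sub_pad_le p q l).trans (hd.supDist_le p q))
  obtain ⟨z, hz⟩ := p.exists_pad_eq_pow_outer l
  obtain ⟨w, hw⟩ := q.exists_pad_eq_pow_outer l
  rw [← ho] at hw
  rw [hz, hw, ← mul_sub, abs_mul, abs_of_pos (by positivity)]
  have hzw : z - w ≠ 0 := by
    intro h0
    rw [sub_eq_zero] at h0
    exact hl (by rw [hz, hw, h0])
  have h1 : (1 : ℝ) ≤ |(z : ℝ) - w| := by exact_mod_cast Int.one_le_abs hzw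
  have h2 : (p.outer : ℝ) ≤ 2 ^ p.outer := by exact_mod_cast Nat.lt_two_pow_self.le
  nlinarith

theorem eq_of_pad_eq {p q : X2omega} (ho : p.outer = q.outer) (hi : p.inner = q.inner)
    (h : p.pad = q.pad) : p = q := by
  refine eq_of_gapDist_eq_zero ?_
  have : supDist p.vec q.vec ≤ 0 := (supDist_le_iff _ _ le_rfl).2 fun l => by
    have := congrFun h l
    simp only [pad] at this
    simp [this]
  simp [gapDist, unionDist, ho, hi, gap_self, le_antisymm this (supDist_nonneg _ _)]

/-- Singletons are not enough: points with equal padded coordinates and small inner indices can be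
closer than `a`. Replacing the inner index by its maximum with `a` merges them at bounded cost; two
values of this maximum differ only when the larger index exceeds `a`, so that the gap is at least
`a`. -/
theorem exists_family_of_le_outer_gapDist (a : ℕ) : ∃ U : Set (Set X2omega),
    UniformlyBdd gapDist U ∧ RDisjoint gapDist a U ∧
      ∀ p : X2omega, a ≤ p.outer → ∃ V ∈ U, p ∈ V := by
  have hd := isGapDist_gapDist
  refine ⟨fibreFamily {p | a ≤ p.outer} fun p => (p.outer, max a p.inner, p.pad),
    uniformlyBdd_fibreFamily (C := ((∑ l ∈ Finset.range a, l : ℕ) : ℝ)) ?_,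
    rDisjoint_fibreFamily ?_, fun p hp => exists_mem_fibreFamily _ hp⟩
  · intro p _ q _ h
    simp only [Prod.mk.injEq] at h
    obtain ⟨ho, hi, hpad⟩ := h
    have hs : supDist p.vec q.vec ≤ 0 := (supDist_le_iff _ _ le_rfl).2 fun l => by
      have := congrFun hpad l
      simp only [pad] at this
      simp [this]
    have hg : gap p.inner q.inner ≤ ∑ l ∈ Finset.range a, l := by
      by_cases hpq : p.inner = q.inner
      · simp [hpq, gap_self]
      · exact gap_le (by omega) (by omega)
    have hg' : (gap p.inner q.inner : ℝ) ≤ ((∑ l ∈ Finset.range a, l : ℕ) : ℝ) := by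
      exact_mod_cast hg
    have h0 : (0 : ℝ) ≤ ((∑ l ∈ Finset.range a, l : ℕ) : ℝ) := Nat.cast_nonneg _
    simp only [gapDist, unionDist, one_mul, ho, gap_self]
    exact max_le (max_le (hs.trans h0) hg') (by simpa using h0)
  · intro p hp q hq h
    by_cases ho : p.outer = q.outer
    · by_cases hpad : p.pad = q.pad
      · have hi : max a p.inner ≠ max a q.inner := fun hi => h (by simp [ho, hi, hpad])
        refine le_trans ?_ (hd.inner_le p q)
        rcases lt_trichotomy p.inner q.inner with hlt | heq | hlt
        · exact_mod_cast le_trans (by omega) (le_gap_of_lt hlt)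
        · exact absurd (by rw [heq]) hi
        · rw [gap_comm]
          exact_mod_cast le_trans (by omega) (le_gap_of_lt hlt)
      · exact le_trans (by exact_mod_cast hp) (hd.le_of_pad_ne ho hpad)
    · exact le_trans (by exact_mod_cast le_gap ho hp hq) (hd.outer_le p q)

/-- Here singletons work: inner gaps are multiplied by an outer index that is at least `a`. -/
theorem exists_family_of_le_outer_weightedDist (a : ℕ) : ∃ U : Set (Set X2omega),
    UniformlyBdd weightedDist U ∧ RDisjoint weightedDist a U ∧
      ∀ p : X2omega, a ≤ p.outer → ∃ V ∈ U, p ∈ V := by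
  have hd := isGapDist_weightedDist
  refine ⟨fibreFamily {p | a ≤ p.outer} id, uniformlyBdd_fibreFamily (C := 0) ?_,
    rDisjoint_fibreFamily ?_, fun p hp => exists_mem_fibreFamily _ hp⟩
  · rintro p _ q _ rfl
    simp [weightedDist, unionDist, supDist_self, gap_self]
  · intro p hp q hq h
    by_cases ho : p.outer = q.outer
    · by_cases hpad : p.pad = q.pad
      · have hi : p.inner ≠ q.inner := fun hi => h (eq_of_pad_eq ho hi hpad)
        have h1 : a ≤ max p.outer q.outer * gap p.inner q.inner := by
          have := le_gap hi p.inner_pos q.inner_pos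
          exact (le_max_of_le_left hp).trans (Nat.le_mul_of_pos_right _ this)
        exact le_trans (by exact_mod_cast h1) ((le_max_right _ _).trans (le_max_left _ _))
      · exact le_trans (by exact_mod_cast hp) (hd.le_of_pad_ne ho hpad)
    · exact le_trans (by exact_mod_cast le_gap ho hp hq) (hd.outer_le p q)

/-- The inner index is unbounded, so it must be part of the label; the gaps between indices from
`i₀` on provide the disjointness, which limits `s`. -/
theorem IsGapDist.exists_family_large (hd : IsGapDist d) (a i₀ : ℕ) {s P : ℝ} (hP : 0 < P)
    (hs : s ≤ i₀) (j : ℕ) : ∃ F : Set (Set X2omega), UniformlyBdd d F ∧ RDisjoint d s F ∧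
      ∀ p : X2omega, p.outer ≤ a → i₀ ≤ p.inner → InBox s P j p.pad → ∃ V ∈ F, p ∈ V := by
  refine ⟨fibreFamily {p | p.outer ≤ a ∧ i₀ ≤ p.inner ∧ InBox s P j p.pad}
    fun p => (p.inner, boxIndex s P j p.pad),
    uniformlyBdd_fibreFamily (C := max P ((∑ l ∈ Finset.range a, l : ℕ) : ℝ)) ?_,
    rDisjoint_fibreFamily ?_, fun p h1 h2 h3 => exists_mem_fibreFamily _ ⟨h1, h2, h3⟩⟩
  · rintro p ⟨hp, -⟩ q ⟨hq, -⟩ h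
    simp only [Prod.mk.injEq] at h
    refine (hd.le_max a p q hp hq).trans (max_le_max (max_le ?_ ?_) ?_)
    · exact (supDist_le_iff _ _ hP.le).2 (abs_sub_le_of_boxIndex_eq hP h.2)
    · simpa [h.1, gap_self] using hP.le
    · exact_mod_cast gap_le hp hq
  · rintro p ⟨-, hpi, hpb⟩ q ⟨-, hqi, hqb⟩ h
    by_cases hi : p.inner = q.inner
    · obtain ⟨l, hl⟩ := exists_le_abs_sub_of_boxIndex_ne hP hpb hqb fun hb => h (by simp [hi, hb])
      exact hl.trans ((abs_pad_sub_pad_le p q l).trans (hd.supDist_le p q))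
    · refine le_trans (hs.trans ?_) (hd.inner_le p q)
      exact_mod_cast le_gap hi hpi hqi

/-- With both indices bounded, all gaps are bounded and can be left out of the label. Disjointness
comes from the boxes alone, so `s` is unrestricted. -/
theorem IsGapDist.exists_family_small (hd : IsGapDist d) (a i₀ : ℕ) {s P : ℝ} (hP : 0 < P)
    (j : ℕ) : ∃ F : Set (Set X2omega), UniformlyBdd d F ∧ RDisjoint d s F ∧
      ∀ p : X2omega, p.outer ≤ a → p.inner ≤ i₀ → InBox s P j p.pad → ∃ V ∈ F, p ∈ V := by
  refine ⟨fibreFamily {p | p.outer ≤ a ∧ p.inner ≤ i₀ ∧ InBox s P j p.pad}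
    fun p => boxIndex s P j p.pad,
    uniformlyBdd_fibreFamily (C := max (max P ((a * ∑ l ∈ Finset.range i₀, l : ℕ) : ℝ))
      ((∑ l ∈ Finset.range a, l : ℕ) : ℝ)) ?_,
    rDisjoint_fibreFamily ?_, fun p h1 h2 h3 => exists_mem_fibreFamily _ ⟨h1, h2, h3⟩⟩
  · rintro p ⟨hp, hpi, -⟩ q ⟨hq, hqi, -⟩ h
    refine (hd.le_max a p q hp hq).trans (max_le_max (max_le_max ?_ ?_) ?_)
    · exact (supDist_le_iff _ _ hP.le).2 (abs_sub_le_of_boxIndex_eq hP h)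
    · exact_mod_cast Nat.mul_le_mul_left _ (gap_le hpi hqi)
    · exact_mod_cast gap_le hp hq
  · rintro p ⟨-, -, hpb⟩ q ⟨-, -, hqb⟩ h
    obtain ⟨l, hl⟩ := exists_le_abs_sub_of_boxIndex_ne hP hpb hqb h
    exact hl.trans ((abs_pad_sub_pad_le p q l).trans (hd.supDist_le p q))

theorem exists_index_of_le_card {α : Type*} (σ : Finset α) :
    ∃ φ : α → ℕ, ∀ j < σ.card, ∃ i ∈ σ, φ i = j := by
  classical
  refine ⟨fun i => if h : i ∈ σ then σ.equivFin ⟨i, h⟩ else 0, fun j hj => ?_⟩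
  refine ⟨σ.equivFin.symm ⟨j, hj⟩, (σ.equivFin.symm ⟨j, hj⟩).2, ?_⟩
  simp

theorem IsGapDist.residualFamily_card_le (hd : IsGapDist d) {a : ℕ+} {U : Set (Set X2omega)}
    (hUb : UniformlyBdd d U) (hUd : RDisjoint d ((a : ℕ) : ℝ) U)
    (hU : ∀ p : X2omega, (a : ℕ) ≤ p.outer → ∃ V ∈ U, p ∈ V) {σ : Finset ℕ+} (ha : a ∉ σ)
    (hσ : σ.card = a) :
    ∃ n : ℕ, ∀ τ ∈ residualFamily (obstructions d) (insert a σ), τ.card ≤ n := by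
  set e := σ.sup fun i => (i : ℕ) with he
  -- The first summand makes inner gaps beyond `i₀` at least the separation `2 ^ e`; the second
  -- makes `2 ^ i` a multiple of the period `2 ^ (e + a)` for `i ≥ i₀`.
  set i₀ := 2 ^ e + (e + a) with hi₀
  refine ⟨i₀, ?_⟩
  rintro τ ⟨-, ⟨-, hno⟩, hdisj⟩
  by_contra! hτ
  refine hno ?_
  rw [← Finset.disjoint_iff_inter_eq_empty, Finset.disjoint_insert_left] at hdisj
  set s : ℝ := ((τ.sup fun i => (i : ℕ) : ℕ) : ℝ) + 1 with hs
  have hspos : 0 < s := by positivity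
  have hP : 0 < ((i₀ + 1 : ℕ) : ℝ) * s := by positivity
  choose F hFb hFd hF using fun j => hd.exists_family_large a i₀ (s := 2 ^ e)
    (P := 2 ^ (e + (a : ℕ))) (by positivity) (by rw [hi₀]; push_cast; linarith [
      (by positivity : (0 : ℝ) ≤ (e : ℝ) + (a : ℕ))]) j
  -- The period `(i₀ + 1) s` has room for `i₀ + 1` strips, more than the number of non-zero
  -- coordinates of a point with inner index below `i₀`.
  choose G hGb hGd hG using fun j => hd.exists_family_small a i₀ (s := s) hP j
  obtain ⟨φ, hφ⟩ := exists_index_of_le_card σ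
  obtain ⟨ψ, hψ⟩ := exists_index_of_le_card τ
  refine ⟨fun i => if i = a then U else if i ∈ σ then F (φ i) else G (ψ i), fun i hi => ?_,
    fun p => ?_⟩
  · dsimp only
    split_ifs with h1 h2
    · subst h1; exact ⟨hUb, hUd⟩
    · refine ⟨hFb _, (hFd _).mono ?_⟩
      have : (i : ℕ) ≤ e := Finset.le_sup (f := fun i : ℕ+ => (i : ℕ)) h2
      exact_mod_cast this.trans Nat.lt_two_pow_self.le
    · have hi : i ∈ τ := by simpa [h1, h2] using hi
      refine ⟨hGb _, (hGd _).mono ?_⟩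
      have : (i : ℕ) ≤ τ.sup fun i => (i : ℕ) := Finset.le_sup (f := fun i : ℕ+ => (i : ℕ)) hi
      rw [hs]
      exact_mod_cast this.trans (Nat.le_succ _)
  · rcases le_or_gt (a : ℕ) p.outer with hp | hp
    · exact ⟨a, by simp, by simpa using hU p hp⟩
    rcases le_or_gt i₀ p.inner with hi | hi
    · obtain ⟨B, hBc, hB⟩ := p.exists_finset_pad_eq
      obtain ⟨j, hj, hbox⟩ := exists_inBox (s := 2 ^ e) (P := 2 ^ (e + (a : ℕ))) (by positivity)
        (N := a) (v := p.pad) (by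
          rw [pow_add, mul_comm]
          refine mul_le_mul_of_nonneg_left ?_ (by positivity)
          exact_mod_cast Nat.lt_two_pow_self.le) B (fun l hl => by
            obtain ⟨z, hz⟩ := hB l hl
            refine ⟨2 ^ (p.inner - (e + a)) * z, ?_⟩
            rw [hz]
            push_cast
            rw [← mul_assoc, ← pow_add, Nat.add_sub_cancel' ((Nat.le_add_left _ _).trans hi)]) (hBc.trans_lt hp)
      obtain ⟨i, hiσ, hij⟩ := hφ j (by omega)
      refine ⟨i, by simp [hiσ], ?_⟩
      have hia : i ≠ a := fun h => ha (h ▸ hiσ)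
      simpa [hia, hiσ, hij] using hF j p hp.le hi hbox
    · obtain ⟨j, hj, hbox⟩ := exists_inBox hspos (le_refl (((i₀ + 1 : ℕ) : ℝ) * s))
        (v := p.pad) (Finset.range p.inner) (fun l hl => ⟨0, by
          simp [pad_eq_zero (not_lt.1 (fun h => hl (Finset.mem_range.2 h)))]⟩)
        (by rw [Finset.card_range]; omega)
      obtain ⟨i, hiτ, hij⟩ := hψ j (by omega)
      refine ⟨i, by simp [hiτ], ?_⟩
      have hia : i ≠ a := fun h => hdisj.1 (h ▸ hiτ)
      have hiσ : i ∉ σ := fun h => Finset.disjoint_left.1 hdisj.2 h hiτ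
      simpa [hia, hiσ, hij] using hG j p hp.le hi.le hbox

end X2omega

/-! ### Mod 2 cubical cycles and their degree -/

section CubicalCycles

variable {ι : Type*} [DecidableEq ι]

/-- `f` is a face of codimension one of `c`. -/
def IsFacet (f c : ι → ℤ) : Prop :=
  ∃ l, Even (f l) ∧ (c = f + Pi.single l 1 ∨ c = f - Pi.single l 1)

theorem IsFacet.abs_sub_le {f c : ι → ℤ} (h : IsFacet f c) (l : ι) : |f l - c l| ≤ 1 := by
  obtain ⟨l', -, h | h⟩ := h <;> subst h <;> by_cases hl : l = l' <;>
    simp_all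

variable [Fintype ι]

/-- The mod 2 boundary of a cubical chain on `ℝ^ι`. A point `c` of `ℤ^ι` stands for the cell whose
`l`-th side is the point `c l / 2` if `c l` is even, and the interval of length `1` centred at
`c l / 2` if `c l` is odd. -/
def cubeBoundary (C : (ι → ℤ) → ZMod 2) (f : ι → ℤ) : ZMod 2 :=
  ∑ l ∈ Finset.univ.filter (fun l => Even (f l)),
    (C (f + Pi.single l 1) + C (f - Pi.single l 1))

/-- The cells whose coordinates outside `S` are those of `t`, and are points in the directions
of `S`. -/
def cubeSlice (S : Finset ι) (t : ι → ℤ) : Set (ι → ℤ) :=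
  {c | (∀ l, l ∉ S → c l = t l) ∧ ∀ l ∈ S, Even (c l)}

theorem cubeBoundary_congr {C D : (ι → ℤ) → ZMod 2} {f : ι → ℤ}
    (h : ∀ c, IsFacet f c → C c = D c) : cubeBoundary C f = cubeBoundary D f := by
  refine Finset.sum_congr rfl fun l hl => ?_
  have hl' := (Finset.mem_filter.1 hl).2
  rw [h _ ⟨l, hl', .inl rfl⟩, h _ ⟨l, hl', .inr rfl⟩]

theorem cubeBoundary_zero (f : ι → ℤ) : cubeBoundary (fun _ => 0) f = 0 := by
  simp [cubeBoundary]

theorem cubeBoundary_one (f : ι → ℤ) : cubeBoundary (fun _ => 1) f = 0 := by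
  simp [cubeBoundary, CharTwo.add_self_eq_zero]

theorem cubeBoundary_add (C D : (ι → ℤ) → ZMod 2) (f : ι → ℤ) :
    cubeBoundary (fun c => C c + D c) f = cubeBoundary C f + cubeBoundary D f := by
  simp only [cubeBoundary, ← Finset.sum_add_distrib]
  exact Finset.sum_congr rfl fun l _ => by ring

theorem filter_even_add_single {f : ι → ℤ} {l : ι} (hl : Even (f l)) {ε : ℤ} (hε : Odd ε) :
    Finset.univ.filter (fun l' => Even ((f + Pi.single l ε : ι → ℤ) l')) =
      (Finset.univ.filter fun l' => Even (f l')).erase l := by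
  ext l'
  by_cases h : l' = l
  · subst h
    simpa using hl.add_odd hε
  · simp [h]

/-- The double boundary is a sum over ordered pairs of distinct directions, symmetric under swapping
them. -/
theorem cubeBoundary_cubeBoundary (C : (ι → ℤ) → ZMod 2) (f : ι → ℤ) :
    cubeBoundary (cubeBoundary C) f = 0 := by
  set E := Finset.univ.filter (fun l => Even (f l)) with hE
  set G : ι × ι → ZMod 2 := fun p =>
    (C (f + Pi.single p.1 1 + Pi.single p.2 1) + C (f + Pi.single p.1 1 - Pi.single p.2 1)) +
    (C (f - Pi.single p.1 1 + Pi.single p.2 1) + C (f - Pi.single p.1 1 - Pi.single p.2 1)) with hG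
  have h1 : cubeBoundary (cubeBoundary C) f = ∑ l ∈ E, ∑ l' ∈ E.erase l, G (l, l') := by
    unfold cubeBoundary
    refine Finset.sum_congr rfl fun l hl => ?_
    have hl' := (Finset.mem_filter.1 hl).2
    rw [filter_even_add_single hl' odd_one, sub_eq_add_neg f, ← Pi.single_neg,
      filter_even_add_single hl' (by decide : Odd (-1 : ℤ)), ← Finset.sum_add_distrib]
    simp only [hG, sub_eq_add_neg, Pi.single_neg, ← hE]
  have h2 : ∑ l ∈ E, ∑ l' ∈ E.erase l, G (l, l') = ∑ p ∈ E.offDiag, G p := by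
    rw [Finset.sum_sigma']
    refine Finset.sum_bij' (fun p _ => (p.1, p.2)) (fun p _ => ⟨p.1, p.2⟩) ?_ ?_ ?_ ?_ ?_
    · rintro ⟨l, l'⟩ h
      simp only [Finset.mem_sigma, Finset.mem_erase] at h
      simp only [Finset.mem_offDiag]
      exact ⟨h.1, h.2.2, h.2.1.symm⟩
    · rintro ⟨l, l'⟩ h
      simp only [Finset.mem_offDiag] at h
      simp only [Finset.mem_sigma, Finset.mem_erase]
      exact ⟨h.1, h.2.2.symm, h.2.1⟩
    · intros; rfl
    · intros; rfl
    · intros; rfl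
  rw [h1, h2]
  refine Finset.sum_involution (fun p _ => p.swap) ?_ ?_ ?_ ?_
  · rintro ⟨l, l'⟩ _
    have : G (l', l) = G (l, l') := by
      simp only [hG, sub_eq_add_neg]
      rw [add_right_comm f (Pi.single l' 1), add_right_comm f (Pi.single l' 1),
        add_right_comm f (-Pi.single l' 1), add_right_comm f (-Pi.single l' 1)]
      ring
    rw [Prod.swap_prod_mk, this, CharTwo.add_self_eq_zero]
  · rintro ⟨l, l'⟩ h _ h'
    simp only [Finset.mem_offDiag] at h
    exact h.2.2 (Prod.ext_iff.1 h').2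
  · rintro ⟨l, l'⟩ h
    simp only [Finset.mem_offDiag] at h
    simp only [Finset.mem_offDiag, Prod.swap_prod_mk]
    exact ⟨h.2.1, h.1, h.2.2.symm⟩
  · intros; rfl

theorem cubeBoundary_of_mem_cubeSlice {S : Finset ι} {t f : ι → ℤ}
    (ht : ∀ l, l ∉ S → Odd (t l)) (hf : f ∈ cubeSlice S t) (C : (ι → ℤ) → ZMod 2) :
    cubeBoundary C f = ∑ l ∈ S, (C (f + Pi.single l 1) + C (f - Pi.single l 1)) := by
  refine Finset.sum_congr ?_ fun _ _ => rfl
  ext l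
  simp only [Finset.mem_filter, Finset.mem_univ, true_and]
  refine ⟨fun h => ?_, fun h => hf.2 l h⟩
  by_contra hl
  rw [hf.1 l hl] at h
  exact (Int.not_even_iff_odd.2 (ht l hl)) h

theorem finsum_mem_sum_comm {α β M : Type*} [AddCommMonoid M] {s : Set α} {t : Finset β}
    {f : β → α → M} (h : ∀ b ∈ t, (s ∩ Function.support (f b)).Finite) :
    ∑ᶠ a ∈ s, ∑ b ∈ t, f b a = ∑ b ∈ t, ∑ᶠ a ∈ s, f b a := by
  rw [finsum_mem_def]
  simp only [finsum_mem_def s]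
  rw [← finsum_sum_comm]
  · refine finsum_congr fun a => ?_
    by_cases ha : a ∈ s <;> simp [ha]
  · intro b hb
    have := h b hb
    rwa [← Set.support_indicator] at this

/-- For each direction `l` in `S`, translation by two units along `l` matches the two sums in the
boundary, which cancel mod 2. -/
theorem finsum_cubeBoundary_eq_zero {S : Finset ι} {t : ι → ℤ}
    (ht : ∀ l, l ∉ S → Odd (t l)) {u : (ι → ℤ) → ZMod 2}
    (hu : {c | u c ≠ 0 ∧ ∀ l, l ∉ S → c l = t l}.Finite) :
    ∑ᶠ f ∈ cubeSlice S t, cubeBoundary u f = 0 := by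
  have hfin : ∀ l ∈ S, ∀ ε : ℤ,
      (cubeSlice S t ∩ Function.support fun f => u (f + Pi.single l ε)).Finite := by
    intro l hl ε
    refine (hu.preimage (f := fun f => f + Pi.single l ε)
      (add_left_injective (Pi.single l ε : ι → ℤ)).injOn).subset ?_
    rintro f ⟨hf, hf'⟩
    refine ⟨hf', fun l' hl' => ?_⟩
    have : l' ≠ l := fun h => hl' (h ▸ hl)
    simp [this, hf.1 l' hl']
  have hsub : ∀ (f : ι → ℤ) l, f - Pi.single l 1 = f + Pi.single l (-1) := fun f l => by
    rw [Pi.single_neg, sub_eq_add_neg]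
  rw [finsum_mem_congr rfl fun f hf => cubeBoundary_of_mem_cubeSlice ht hf u]
  simp only [hsub]
  rw [finsum_mem_sum_comm]
  · refine Finset.sum_eq_zero fun l hl => ?_
    rw [finsum_mem_add_distrib' (hfin l hl 1) (hfin l hl (-1))]
    have : ∑ᶠ f ∈ cubeSlice S t, u (f + Pi.single l 1) =
        ∑ᶠ f ∈ cubeSlice S t, u (f + Pi.single l (-1)) := by
      refine finsum_mem_eq_of_bijOn (fun f => f + Pi.single l 2) ⟨?_, ?_, ?_⟩ ?_
      · intro f hf
        refine ⟨fun l' hl' => ?_, fun l' hl' => ?_⟩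
        · have : l' ≠ l := fun h => hl' (h ▸ hl)
          simp [this, hf.1 l' hl']
        · by_cases h : l' = l
          · subst h; simpa using (hf.2 l' hl').add even_two
          · simpa [h] using hf.2 l' hl'
      · exact (add_left_injective _).injOn
      · intro f hf
        refine ⟨f + Pi.single l (-2), ⟨fun l' hl' => ?_, fun l' hl' => ?_⟩, ?_⟩
        · have : l' ≠ l := fun h => hl' (h ▸ hl)
          simp [this, hf.1 l' hl']
        · by_cases h : l' = l
          · subst h; simpa using (hf.2 l' hl').add (by decide : Even (-2 : ℤ))
          · simpa [h] using hf.2 l' hl'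
        · simp [add_assoc, ← Pi.single_add]
      · intro f _
        simp [add_assoc, ← Pi.single_add]
    rw [this, CharTwo.add_self_eq_zero]
  · intro l hl
    refine ((hfin l hl 1).union (hfin l hl (-1))).subset ?_
    rintro f ⟨hf, hf'⟩
    by_contra hc
    simp only [Set.mem_union, Set.mem_inter_iff, Function.mem_support, not_or, not_and,
      not_not] at hc
    exact hf' (by simp [hc.1 hf, hc.2 hf])

/-- A mod 2 cubical cycle, bounded in the directions of `S`, that meets every slice orthogonal to
the remaining directions an odd number of times. -/
structure IsSliceCycle (S : Finset ι) (C : (ι → ℤ) → ZMod 2) : Prop where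
  closed : ∀ f, cubeBoundary C f = 0
  bdd : ∃ N : ℤ, ∀ c, C c ≠ 0 → ∀ l ∈ S, |c l| ≤ N
  degree : ∀ t : ι → ℤ, (∀ l, l ∉ S → Odd (t l)) → ∑ᶠ c ∈ cubeSlice S t, C c = 1

/-- Chains may mix dimensions; the degree for `S` sees only cells that are intervals exactly in the
directions outside `S`. -/
theorem isSliceCycle_one : IsSliceCycle (∅ : Finset ι) (fun _ => 1) where
  closed := cubeBoundary_one
  bdd := ⟨0, by simp⟩
  degree t _ := by
    have : cubeSlice ∅ t = {t} := by
      ext c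
      simp [cubeSlice, funext_iff]
    rw [this, finsum_mem_singleton]

/-- If all cells of `C` around `f` lay on one side of `L`, the boundary at `f` would be that of `0`
or of the cycle `C`. -/
theorem IsSliceCycle.exists_facet {S : Finset ι} {C : (ι → ℤ) → ZMod 2}
    (hC : IsSliceCycle S C) {L : (ι → ℤ) → Prop} [DecidablePred L] {f : ι → ℤ}
    (hf : cubeBoundary (fun c => if L c then C c else 0) f ≠ 0) :
    ∃ c c', IsFacet f c ∧ IsFacet f c' ∧ C c ≠ 0 ∧ C c' ≠ 0 ∧ L c ∧ ¬ L c' := by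
  have h1 : ∃ c, IsFacet f c ∧ C c ≠ 0 ∧ L c := by
    by_contra! h
    refine hf ?_
    rw [cubeBoundary_congr (D := fun _ => 0), cubeBoundary_zero]
    intro c hc
    by_cases h0 : C c = 0
    · simp [h0]
    · simp [h c hc h0]
  have h2 : ∃ c, IsFacet f c ∧ C c ≠ 0 ∧ ¬ L c := by
    by_contra! h
    refine hf ?_
    rw [cubeBoundary_congr (D := C), hC.closed]
    intro c hc
    by_cases h0 : C c = 0
    · simp [h0]
    · simp [h c hc h0]
  obtain ⟨c, hc1, hc2, hc3⟩ := h1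
  obtain ⟨c', hc1', hc2', hc3'⟩ := h2
  exact ⟨c, c', hc1, hc1', hc2, hc2', hc3, hc3'⟩

theorem cubeBoundary_halfSpace {C : (ι → ℤ) → ZMod 2} (hC : ∀ f, cubeBoundary C f = 0) {d : ι}
    {f : ι → ℤ} (hf : Even (f d)) :
    cubeBoundary (fun c => if c d ≤ 0 then C c else 0) f =
      if f d = 0 then C (f + Pi.single d 1) else 0 := by
  split_ifs with h0
  · have h1 : cubeBoundary (fun c => if c d ≤ 0 then C c else 0) f + cubeBoundary C f =
        C (f + Pi.single d 1) := by
      unfold cubeBoundary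
      rw [← Finset.sum_add_distrib, Finset.sum_eq_single d]
      · simp only [Pi.add_apply, Pi.sub_apply, Pi.single_eq_same, h0]
        have := CharTwo.add_self_eq_zero (C (f - Pi.single d 1))
        simp only [zero_add, zero_sub, Left.neg_nonpos_iff, zero_le_one, if_true,
          show ¬ ((1 : ℤ) ≤ 0) by decide, if_false]
        linear_combination this
      · intro l _ hl
        simp only [Pi.add_apply, Pi.sub_apply, Pi.single_eq_of_ne hl.symm, h0]
        simp [CharTwo.add_self_eq_zero]
      · intro h
        simp [hf] at h
    rwa [hC, add_zero] at h1
  · by_cases h : f d ≤ 0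
    · rw [cubeBoundary_congr (D := C), hC]
      intro c hc
      have := abs_le.1 (hc.abs_sub_le d)
      obtain ⟨r, hr⟩ := hf
      rw [if_pos (by omega)]
    · rw [cubeBoundary_congr (D := fun _ => 0), cubeBoundary_zero]
      intro c hc
      have := abs_le.1 (hc.abs_sub_le d)
      obtain ⟨r, hr⟩ := hf
      rw [if_neg (by omega)]

/-- The part of `C` in `L` differs from its part in the half-space `c d ≤ 0` by a chain `u` that is
finite over each slice, so both boundaries have the same degree. For the half-space the boundary is
the section of `C` just above `c d = 0`, whose degree is that of `C`. -/
theorem IsSliceCycle.cut {S : Finset ι} {C : (ι → ℤ) → ZMod 2} (hC : IsSliceCycle S C)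
    {d : ι} (hd : d ∉ S) {L : (ι → ℤ) → Prop} [DecidablePred L] {N : ℤ}
    (hlow : ∀ c, c d ≤ 0 → L c) (hhigh : ∀ c, N < c d → ¬ L c) :
    IsSliceCycle (insert d S) (cubeBoundary fun c => if L c then C c else 0) := by
  obtain ⟨B, hB⟩ := hC.bdd
  refine ⟨cubeBoundary_cubeBoundary _, ⟨max (B + 1) (|N| + 1), fun f hf l hl => ?_⟩, ?_⟩
  · obtain ⟨c, c', h1, h2, h3, h4, h5, h6⟩ := hC.exists_facet hf
    have h1l := abs_le.1 (h1.abs_sub_le l)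
    rcases Finset.mem_insert.1 hl with rfl | hl
    · have h2l := abs_le.1 (h2.abs_sub_le l)
      have h7 : 0 < c' l := not_le.1 fun h => h6 (hlow c' h)
      have h8 : c l ≤ N := not_lt.1 fun h => hhigh c h h5
      refine le_max_of_le_right (abs_le.2 ?_)
      have := le_abs_self N
      have := abs_nonneg N
      constructor <;> omega
    · have := abs_le.1 (hB c h3 l hl)
      exact le_max_of_le_left (abs_le.2 (by constructor <;> omega))
  · intro t ht
    set u : (ι → ℤ) → ZMod 2 := fun c =>
      (if L c then C c else 0) + (if c d ≤ 0 then C c else 0) with hu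
    have hsplit : (fun c => if L c then C c else 0) =
        fun c => u c + (if c d ≤ 0 then C c else 0) := by
      funext c
      rw [hu]
      simp only [add_assoc, CharTwo.add_self_eq_zero, add_zero]
    have hufin : {c | u c ≠ 0 ∧ ∀ l, l ∉ insert d S → c l = t l}.Finite := by
      refine (Set.finite_Icc (fun l => if l ∈ S then -B else if l = d then 0 else t l)
        (fun l => if l ∈ S then B else if l = d then |N| else t l)).subset ?_
      rintro c ⟨hc, hct⟩
      have hCc : C c ≠ 0 := fun h => hc (by simp [hu, h])
      have hcd : 0 ≤ c d ∧ c d ≤ |N| := by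
        constructor
        · by_contra! h
          exact hc (by simp [hu, hlow c h.le, h.le, CharTwo.add_self_eq_zero])
        · by_contra! h
          have h1 := le_abs_self N
          have h2 := abs_nonneg N
          exact hc (by simp [hu, hhigh c (by omega), show ¬ c d ≤ 0 by omega])
      rw [Set.mem_Icc, Pi.le_def, Pi.le_def, ← forall_and]
      intro l
      by_cases hl : l ∈ S
      · simpa [hl] using abs_le.1 (hB c hCc l hl)
      · by_cases hld : l = d
        · subst hld; simpa [hl] using hcd
        · simp [hl, hld, hct l (by simp [hl, hld])]
    have hshift : ∑ᶠ f ∈ cubeSlice (insert d S) t, (if f d = 0 then C (f + Pi.single d 1) else 0) =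
        1 := by
      -- The value `1` is odd and is the `d`-coordinate of the cells adjacent to the hyperplane from
      -- above.
      rw [← hC.degree (Function.update t d 1) ?_]
      · have h1 : ∀ f ∈ cubeSlice (insert d S) t,
            (if f d = 0 then C (f + Pi.single d 1) else 0) ≠ 0 → f d = 0 := by
          intro f _ h
          by_contra h0
          simp [h0] at h
        refine (finsum_mem_inter_support _ _).symm.trans
          (Eq.trans ?_ (finsum_mem_inter_support _ _))
        refine finsum_mem_eq_of_bijOn (fun f => f + Pi.single d 1) ⟨?_, ?_, ?_⟩ ?_
        · rintro f ⟨hf, hf'⟩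
          have h0 := h1 f hf hf'
          refine ⟨⟨fun l hl => ?_, fun l hl => ?_⟩, ?_⟩
          · by_cases hld : l = d
            · subst hld; simp [h0]
            · simp [hld, hf.1 l (by simp [hl, hld])]
          · have hld : l ≠ d := fun h => hd (h ▸ hl)
            simpa [hld] using hf.2 l (by simp [hl])
          · simpa [h0] using hf'
        · exact (add_left_injective _).injOn
        · rintro c ⟨hc, hc'⟩
          have hcd : c d = 1 := by simpa using hc.1 d hd
          refine ⟨c + Pi.single d (-1), ⟨⟨fun l hl => ?_, fun l hl => ?_⟩, ?_⟩, ?_⟩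
          · simp only [Finset.mem_insert, not_or] at hl
            simpa [hl.1] using hc.1 l hl.2
          · by_cases hld : l = d
            · subst hld; simp [hcd]
            · have hlS : l ∈ S := by simpa [hld] using hl
              simpa [hld] using hc.2 l hlS
          · simpa [hcd, add_assoc, ← Pi.single_add] using hc'
          · simp [add_assoc, ← Pi.single_add]
        · rintro f ⟨hf, hf'⟩
          simp [h1 f hf hf']
      · intro l hl
        by_cases hld : l = d
        · subst hld; simp
        · simpa [hld] using ht l (by simp [hl, hld])
    have hcut : ∀ f ∈ cubeSlice (insert d S) t,
        cubeBoundary (fun c => if L c then C c else 0) f =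
          cubeBoundary u f + (if f d = 0 then C (f + Pi.single d 1) else 0) := by
      intro f hf
      rw [hsplit, cubeBoundary_add, cubeBoundary_halfSpace hC.closed (hf.2 d (by simp))]
    rw [finsum_mem_congr rfl hcut, finsum_mem_add_distrib', finsum_cubeBoundary_eq_zero ht hufin,
      hshift, zero_add]
    · refine (Set.finite_iUnion (ι := ι × Bool) (f := fun i : ι × Bool =>
        (fun f : ι → ℤ => f + Pi.single i.1 (if i.2 then 1 else -1)) ⁻¹'
          {c | u c ≠ 0 ∧ ∀ l, l ∉ insert d S → c l = t l}) fun i => hufin.preimage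
          (add_left_injective (Pi.single i.1 (if i.2 then 1 else -1) : ι → ℤ)).injOn).subset ?_
      rintro f ⟨hf, hf'⟩
      by_contra hc
      refine hf' ?_
      rw [cubeBoundary_of_mem_cubeSlice ht hf]
      refine Finset.sum_eq_zero fun l hl => ?_
      have key : ∀ ε : ℤ, ∀ l', l' ∉ insert d S → (f + Pi.single l ε : ι → ℤ) l' = t l' := by
        intro ε l' hl'
        have : l' ≠ l := fun h => hl' (h ▸ hl)
        simp [this, hf.1 l' hl']
      simp only [Set.mem_iUnion, Set.mem_preimage, Set.mem_ofPred_eq, not_exists, not_and] at hc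
      have h1 : u (f + Pi.single l 1) = 0 := by
        by_contra h
        exact hc (l, true) h (key 1)
      have h2 : u (f - Pi.single l 1) = 0 := by
        by_contra h
        rw [sub_eq_add_neg, ← Pi.single_neg] at h
        exact hc (l, false) h (key (-1))
      rw [h1, h2, add_zero]
    -- An infinite support would give the sum its default value `0`, but it is `1`.
    · by_contra hinf
      have := finsum_mem_eq_zero_of_infinite hinf
      rw [hshift] at this
      exact one_ne_zero this

end CubicalCycles

/-! ### Cutting cycles along separated families -/

section Zones

variable {ι : Type*}

/-- The closed carrier of the cell `c` in the grid of mesh `m`. -/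
def gridCarrier (m : ℤ) (c : ι → ℤ) : Set (ι → ℤ) :=
  {q | ∀ l, m * (c l / m) ≤ q l ∧ q l ≤ -(m * (-c l / m))}

theorem abs_sub_le_of_mem_gridCarrier {m : ℤ} (hm : 0 < m) {c p q : ι → ℤ}
    (hp : p ∈ gridCarrier m c) (hq : q ∈ gridCarrier m c) (l : ι) : |p l - q l| ≤ m := by
  obtain ⟨h1, h2⟩ := hp l
  obtain ⟨h3, h4⟩ := hq l
  have h5 : -c l < m * (-c l / m) + m := Int.lt_mul_ediv_self_add hm
  have h6 : c l < m * (c l / m) + m := Int.lt_mul_ediv_self_add hm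
  have h7 : m * (c l / m) ≤ c l := Int.mul_ediv_self_le hm.ne'
  have h8 : m * (-c l / m) ≤ -c l := Int.mul_ediv_self_le hm.ne'
  have key : -(m * (-c l / m)) ≤ m * (c l / m) + m := by
    have h9 : -(-c l / m) < c l / m + 2 := by
      by_contra! h
      nlinarith
    have h10 : -(-c l / m) ≤ c l / m + 1 := by omega
    nlinarith
  rw [abs_le]
  constructor <;> linarith

theorem self_mem_gridCarrier {m : ℤ} (hm : 0 < m) (c : ι → ℤ) : c ∈ gridCarrier m c := fun l =>
  ⟨Int.mul_ediv_self_le hm.ne', by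
    have : m * (-c l / m) ≤ -c l := Int.mul_ediv_self_le hm.ne'
    linarith⟩

theorem gridCarrier_subset {m : ℤ} (hm : 0 < m) {f c : ι → ℤ} (h : f ∈ gridCarrier m c) :
    gridCarrier m f ⊆ gridCarrier m c := by
  intro q hq l
  obtain ⟨h1, h2⟩ := h l
  obtain ⟨h3, h4⟩ := hq l
  have h5 : c l / m ≤ f l / m := Int.le_ediv_of_mul_le hm (by linarith)
  have h6 : -c l / m ≤ -f l / m := Int.le_ediv_of_mul_le hm (by linarith)
  constructor <;> nlinarith

/-- In the direction that changes, `c` is odd while the ends of its carrier are even, so one unit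
step does not leave the carrier. -/
theorem IsFacet.mem_gridCarrier [DecidableEq ι] {m : ℤ} (hm : 0 < m) (hm2 : Even m) {f c : ι → ℤ}
    (h : IsFacet f c) : f ∈ gridCarrier m c := by
  obtain ⟨l', hl', h⟩ := h
  intro l
  by_cases hl : l = l'
  · subst hl
    have hc : c l = f l + 1 ∨ c l = f l - 1 := by
      rcases h with h | h <;> simp [h]
    obtain ⟨h1, h2⟩ := self_mem_gridCarrier hm c l
    obtain ⟨x, hx⟩ := hm2.mul_right (c l / m)
    obtain ⟨y, hy⟩ := hm2.mul_right (-c l / m)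
    obtain ⟨z, hz⟩ := hl'
    constructor <;> omega
  · have hc : c l = f l := by
      rcases h with h | h <;> simp [h, hl]
    rw [← hc]
    exact self_mem_gridCarrier hm c l

theorem IsFacet.gridCarrier_subset [DecidableEq ι] {m : ℤ} (hm : 0 < m) (hm2 : Even m)
    {f c : ι → ℤ} (h : IsFacet f c) : gridCarrier m f ⊆ gridCarrier m c :=
  _root_.gridCarrier_subset hm (h.mem_gridCarrier hm hm2)

theorem IsFacet.not_dvd [DecidableEq ι] {m : ℤ} (hm2 : Even m) {f c : ι → ℤ}
    (h : IsFacet f c) {l : ι} (hl : ¬ m ∣ f l) : ¬ m ∣ c l := by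
  obtain ⟨l', hl', h⟩ := h
  by_cases hll : l = l'
  · subst hll
    have hc : Odd (c l) := by
      rcases h with h | h
      · simpa [h] using hl'.add_odd odd_one
      · simpa [h] using hl'.sub_odd odd_one
    intro hd
    exact Int.not_even_iff_odd.2 hc (even_iff_two_dvd.2 (hm2.two_dvd.trans hd))
  · have hc : c l = f l := by
      rcases h with h | h <;> simp [h, hll]
    rwa [hc]

theorem IsFacet.gridCarrier_eq_of_not_dvd [DecidableEq ι] {m : ℤ} (hm : 0 < m) (hm2 : Even m)
    {f c : ι → ℤ} (h : IsFacet f c) (hd : ∀ l, ¬ m ∣ c l → ¬ m ∣ f l) :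
    gridCarrier m c = gridCarrier m f := by
  refine (_root_.gridCarrier_subset hm ?_).antisymm (h.gridCarrier_subset hm hm2)
  obtain ⟨l', hl', h⟩ := h
  intro l
  by_cases hl : l = l'
  · subst hl
    have hc : c l = f l + 1 ∨ c l = f l - 1 := by
      rcases h with h | h <;> simp [h]
    have hco : Odd (c l) := by
      rcases hc with h | h
      · rw [h]; exact hl'.add_odd odd_one
      · rw [h]; exact hl'.sub_odd odd_one
    have hmf : ¬ m ∣ f l := hd l fun hd' =>
      Int.not_even_iff_odd.2 hco (even_iff_two_dvd.2 (hm2.two_dvd.trans hd'))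
    obtain ⟨h1, h2⟩ := self_mem_gridCarrier hm f l
    have h3 : m * (f l / m) ≠ f l := fun h => hmf ⟨_, h.symm⟩
    have h4 : m * (-f l / m) ≠ -f l := fun h => hmf ((Int.dvd_neg).1 ⟨_, h.symm⟩)
    obtain ⟨x, hx⟩ := hm2.mul_right (f l / m)
    obtain ⟨y, hy⟩ := hm2.mul_right (-f l / m)
    obtain ⟨z, hz⟩ := hl'
    constructor <;> omega
  · have hc : c l = f l := by
      rcases h with h | h <;> simp [h, hl]
    rw [hc]
    exact self_mem_gridCarrier hm f l

variable [Fintype ι] [DecidableEq ι]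

/-- Cutting a slice cycle along the members of a bounded family, whose members are far apart
relative to the mesh `m`, that meet a half-space. -/
theorem IsSliceCycle.exists_cut {S : Finset ι} {C : (ι → ℤ) → ZMod 2} (hC : IsSliceCycle S C)
    {d : ι} (hd : d ∉ S) {m B : ℤ} (hm : 0 < m) (hm2 : Even m) {𝒲 : Set (Set (ι → ℤ))}
    (hbdd : ∀ W ∈ 𝒲, ∀ p ∈ W, ∀ q ∈ W, |p d - q d| ≤ B)
    (hsep : ∀ W ∈ 𝒲, ∀ W' ∈ 𝒲, W ≠ W' → ∀ p ∈ W, ∀ q ∈ W', ∃ l, m < |p l - q l|) :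
    ∃ C' : (ι → ℤ) → ZMod 2, IsSliceCycle (insert d S) C' ∧ ∀ f, C' f ≠ 0 →
      (∃ c c', IsFacet f c ∧ IsFacet f c' ∧ C c ≠ 0 ∧ C c' ≠ 0 ∧
        gridCarrier m c ≠ gridCarrier m c') ∧
      ∀ W ∈ 𝒲, ∀ q ∈ W, q ∉ gridCarrier m f := by
  classical
  set L : (ι → ℤ) → Prop := fun c => (∀ q ∈ gridCarrier m c, q d ≤ 0) ∨
    ∃ W ∈ 𝒲, (∃ q ∈ W, q ∈ gridCarrier m c) ∧ ∃ p ∈ W, p d ≤ 0 with hL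
  have hlow : ∀ c : ι → ℤ, c d ≤ 0 → L c := by
    intro c hc
    refine .inl fun q hq => (hq d).2.trans ?_
    have : 0 ≤ -c d / m := Int.ediv_nonneg (by linarith) hm.le
    nlinarith
  have hhigh : ∀ c : ι → ℤ, |B| + m < c d → ¬ L c := by
    rintro c hc (h | ⟨W, hW, ⟨q, hq, hqc⟩, p, hp, hpd⟩)
    · have := h c (self_mem_gridCarrier hm c)
      have := abs_nonneg B
      omega
    · have h1 := (hqc d).1
      have h2 : c d < m * (c d / m) + m := Int.lt_mul_ediv_self_add hm
      have h3 := (abs_le.1 (hbdd W hW p hp q hq)).1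
      have h4 := le_abs_self B
      omega
  refine ⟨_, hC.cut hd hlow hhigh, fun f hf => ?_⟩
  obtain ⟨c, c', h1, h2, h3, h4, h5, h6⟩ := hC.exists_facet hf
  refine ⟨⟨c, c', h1, h2, h3, h4, fun h => h6 ?_⟩, fun W hW q hq hqf => ?_⟩
  · simpa only [hL, h] using h5
  · have hqc := h1.gridCarrier_subset hm hm2 hqf
    have hqc' := h2.gridCarrier_subset hm hm2 hqf
    -- A member meeting the carrier of `f` also meets those of `c` and `c'`. As `c'` is not in `L`,
    -- it stays above the hyperplane; so `c` is in `L` because of another member, within `m` of the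
    -- first.
    have hWhigh : ∀ p ∈ W, ¬ p d ≤ 0 := fun p hp hpd =>
      h6 (.inr ⟨W, hW, ⟨q, hq, hqc'⟩, p, hp, hpd⟩)
    rcases h5 with h5 | ⟨W', hW', ⟨q', hq', hqc''⟩, p, hp, hpd⟩
    · exact hWhigh q hq (h5 q hqc)
    · by_cases hWW : W = W'
      · subst hWW; exact hWhigh p hp hpd
      · obtain ⟨l, hl⟩ := hsep W hW W' hW' hWW q hq q' hq'
        exact absurd (abs_sub_le_of_mem_gridCarrier hm hqc hqc'' l) (not_le.2 hl)

/-- The directions in which `c` is not a vertex of the grid of mesh `m`. -/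
def offGrid (m : ℤ) (c : ι → ℤ) : Finset ι := Finset.univ.filter fun l => ¬ m ∣ c l

theorem IsFacet.offGrid_subset {m : ℤ} (hm2 : Even m) {f c : ι → ℤ} (h : IsFacet f c) :
    offGrid m f ⊆ offGrid m c := by
  intro l hl
  simp only [offGrid, Finset.mem_filter, Finset.mem_univ, true_and] at hl ⊢
  exact h.not_dvd hm2 hl

/-- If neither inclusion were strict, both carriers would equal that of `f`. This is how a cut
lowers the dimension of the coarse skeleton. -/
theorem IsFacet.offGrid_ssubset_or {m : ℤ} (hm : 0 < m) (hm2 : Even m) {f c c' : ι → ℤ}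
    (h : IsFacet f c) (h' : IsFacet f c') (hne : gridCarrier m c ≠ gridCarrier m c') :
    offGrid m f ⊂ offGrid m c ∨ offGrid m f ⊂ offGrid m c' := by
  by_contra! hc
  refine hne ?_
  have key : ∀ c, IsFacet f c → ¬ offGrid m f ⊂ offGrid m c →
      gridCarrier m c = gridCarrier m f := by
    intro c h hc
    refine h.gridCarrier_eq_of_not_dvd hm hm2 fun l hl => ?_
    have hsub : offGrid m c ⊆ offGrid m f := by
      by_contra hs
      exact hc ⟨h.offGrid_subset hm2, hs⟩
    have := hsub (x := l) (by simpa [offGrid] using hl)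
    simpa [offGrid] using this
  rw [key c h hc.1, key c' h' hc.2]

/-- Bounded families indexed by the directions of `ℤ^ι`, separated at a coarse scale for the
directions in `T` and at the fine scale for the others, do not cover the vertices of the fine grid
that lie on the skeleton of dimension `|ι| - |T|` of the coarse grid. -/
theorem exists_uncovered_vertex {T : Finset ι} {m : ℤ} (hm : 0 < m) (hm2 : Even m)
    (𝒲 : ι → Set (Set (ι → ℤ)))
    (hbdd : ∀ d, ∃ B : ℤ, ∀ W ∈ 𝒲 d, ∀ p ∈ W, ∀ q ∈ W, |p d - q d| ≤ B)
    (hcoarse : ∀ d ∈ T, ∀ W ∈ 𝒲 d, ∀ W' ∈ 𝒲 d, W ≠ W' → ∀ p ∈ W, ∀ q ∈ W',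
      ∃ l, m < |p l - q l|)
    (hfine : ∀ d, d ∉ T → ∀ W ∈ 𝒲 d, ∀ W' ∈ 𝒲 d, W ≠ W' → ∀ p ∈ W, ∀ q ∈ W',
      ∃ l, 2 < |p l - q l|) :
    ∃ q : ι → ℤ, (∀ l, Even (q l)) ∧ (offGrid m q).card + T.card ≤ Fintype.card ι ∧
      ∀ d, ∀ W ∈ 𝒲 d, q ∉ W := by
  have h2 : (0 : ℤ) < 2 := by decide
  have hcoarseStep : ∀ S ⊆ T, ∃ C : (ι → ℤ) → ZMod 2, IsSliceCycle S C ∧ ∀ f, C f ≠ 0 →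
      (offGrid m f).card + S.card ≤ Fintype.card ι ∧
      ∀ d ∈ S, ∀ W ∈ 𝒲 d, ∀ q ∈ W, q ∉ gridCarrier m f := by
    intro S
    induction S using Finset.induction_on with
    | empty =>
      exact fun _ => ⟨_, isSliceCycle_one, fun f _ => ⟨by
        simpa using Finset.card_le_univ (offGrid m f), by simp⟩⟩
    | insert d S hdS ih =>
      intro hST
      obtain ⟨C, hC, hCS⟩ := ih ((Finset.subset_insert _ _).trans hST)
      obtain ⟨B, hB⟩ := hbdd d
      obtain ⟨C', hC', hcut⟩ := hC.exists_cut hdS hm hm2 hB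
        (hcoarse d (hST (Finset.mem_insert_self _ _)))
      refine ⟨C', hC', fun f hf => ?_⟩
      obtain ⟨⟨c, c', h1, h2, h3, h4, h5⟩, h6⟩ := hcut f hf
      refine ⟨?_, fun e he => ?_⟩
      · rw [Finset.card_insert_of_notMem hdS]
        rcases h1.offGrid_ssubset_or hm hm2 h2 h5 with h | h
        · have := Finset.card_lt_card h
          have := (hCS c h3).1
          omega
        · have := Finset.card_lt_card h
          have := (hCS c' h4).1
          omega
      · rcases Finset.mem_insert.1 he with rfl | he
        · exact h6
        · exact fun W hW q hq hqf =>
            (hCS c h3).2 e he W hW q hq (h1.gridCarrier_subset hm hm2 hqf)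
  -- Passing to faces shrinks coarse carriers and `offGrid`, so fine cuts preserve what the coarse
  -- cuts achieved.
  have hfineStep : ∀ S, Disjoint S T → ∃ C : (ι → ℤ) → ZMod 2, IsSliceCycle (S ∪ T) C ∧
      ∀ f, C f ≠ 0 → (offGrid m f).card + T.card ≤ Fintype.card ι ∧
      (∀ d ∈ S, ∀ W ∈ 𝒲 d, ∀ q ∈ W, q ∉ gridCarrier 2 f) ∧
      ∀ d ∈ T, ∀ W ∈ 𝒲 d, ∀ q ∈ W, q ∉ gridCarrier m f := by
    intro S
    induction S using Finset.induction_on with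
    | empty =>
      intro _
      obtain ⟨C, hC, hCT⟩ := hcoarseStep T subset_rfl
      exact ⟨C, by simpa using hC, fun f hf => ⟨(hCT f hf).1, by simp, (hCT f hf).2⟩⟩
    | insert d S hdS ih =>
      intro hST
      rw [Finset.disjoint_insert_left] at hST
      obtain ⟨C, hC, hCS⟩ := ih hST.2
      obtain ⟨B, hB⟩ := hbdd d
      obtain ⟨C', hC', hcut⟩ := hC.exists_cut (by simp [hdS, hST.1]) h2 even_two hB
        (hfine d hST.1)
      refine ⟨C', by rwa [Finset.insert_union], fun f hf => ?_⟩
      obtain ⟨⟨c, c', h1, -, h3, -, -⟩, h6⟩ := hcut f hf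
      obtain ⟨hc1, hc2, hc3⟩ := hCS c h3
      refine ⟨?_, fun e he => ?_, fun e he W hW q hq hqf =>
        hc3 e he W hW q hq (h1.gridCarrier_subset hm hm2 hqf)⟩
      · have := Finset.card_le_card (h1.offGrid_subset hm2)
        omega
      · rcases Finset.mem_insert.1 he with rfl | he
        · exact h6
        · exact fun W hW q hq hqf =>
            hc2 e he W hW q hq (h1.gridCarrier_subset h2 even_two hqf)
  obtain ⟨C, hC, hCf⟩ := hfineStep Tᶜ disjoint_compl_left
  have hu : ∀ l, l ∈ Tᶜ ∪ T := fun l => by simp [em']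
  -- With every direction cut, the slice consists of all fine vertices, and degree `1` forces one
  -- into the support.
  obtain ⟨f, hfs, hf⟩ : ∃ f ∈ cubeSlice (Tᶜ ∪ T) 0, C f ≠ 0 := by
    by_contra! h
    have h1 := hC.degree 0 fun l hl => absurd (hu l) hl
    rw [finsum_mem_congr rfl h] at h1
    simp at h1
  obtain ⟨h3, h4, h5⟩ := hCf f hf
  refine ⟨f, fun l => hfs.2 l (hu l), h3, fun d W hW hfW => ?_⟩
  by_cases hd : d ∈ T
  · exact h5 d hd W hW f hfW (self_mem_gridCarrier hm f)
  · exact h4 d (Finset.mem_compl.2 hd) W hW f hfW (self_mem_gridCarrier h2 f)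

end Zones

/-! ### Lower bound and conclusion -/

theorem exists_finset_pnat_card_eq (N k : ℕ) :
    ∃ σ : Finset ℕ+, σ.card = k ∧ ∀ i ∈ σ, N < (i : ℕ) := by
  refine ⟨(Finset.range k).map ⟨fun j => Nat.succPNat (N + j), fun a b h => ?_⟩, by simp, ?_⟩
  · exact Nat.add_left_cancel (Nat.succPNat_injective h)
  · intro i hi
    obtain ⟨j, -, rfl⟩ := Finset.mem_map.1 hi
    exact Nat.lt_succ_of_le (Nat.le_add_right N j)

namespace X2omega

variable {d : X2omega → X2omega → ℝ}

/-- The scaling is by `2 ^ k / 2`, as cell codes are doubled coordinates: even numbers go to `2^k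
ℤ`, multiples of `2 * 2 ^ n` to `2^(k+n) ℤ`. -/
theorem exists_point_of_card_offGrid_le {k n : ℕ} (hk : 0 < k) {q : Fin (k + n) → ℤ}
    (heven : ∀ l, Even (q l)) (hq : (offGrid (2 * 2 ^ n) q).card ≤ k) :
    ∃ p : X2omega, p.outer = k ∧ p.inner = k + n ∧
      ∀ l : Fin (k + n), p.pad l * 2 = 2 ^ k * (q l : ℝ) := by
  choose z hz using heven
  refine ⟨⟨⟨k, hk⟩, ⟨⟨k + n, by omega⟩, ⟨fun l => 2 ^ k * (z l : ℝ), ?_, fun l => ⟨z l, rfl⟩⟩⟩⟩, rfl,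
    rfl, fun l => ?_⟩
  · refine le_trans ?_ hq
    rw [← Set.ncard_coe_finset]
    refine Set.ncard_le_ncard (fun l hl => ?_) (Finset.finite_toSet _)
    simp only [offGrid, Finset.coe_filter, Finset.mem_univ, true_and]
    rintro ⟨w, hw⟩
    refine hl ⟨w, ?_⟩
    have : z l = 2 ^ n * w := by
      have := hz l
      linarith
    change (2 : ℝ) ^ k * (z l : ℝ) = 2 ^ (k + n) * (w : ℝ)
    rw [this]
    push_cast
    ring
  · have h1 : padZero (fun l : Fin (k + n) => 2 ^ k * (z l : ℝ)) l = 2 ^ k * (z l : ℝ) := by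
      simp [padZero]
    refine (congrArg (· * 2) h1).trans ?_
    rw [hz l]
    push_cast
    ring

/-- Inside the single piece `Y_k^{(k+n)}` all gaps vanish and `d` is the sup-distance. The families
for `τ` are separated beyond the coarse mesh `2 ^ (k + n)`, those for `σ` beyond the fine mesh `2 ^
k`. -/
theorem IsGapDist.union_mem_obstructions (hd : IsGapDist d) {k n : ℕ} (hk : 0 < k)
    {σ τ : Finset ℕ+} (hστ : Disjoint σ τ) (hσc : σ.card = k) (hτc : τ.card = n)
    (hσ : ∀ i ∈ σ, 2 ^ k < (i : ℕ)) (hτ : ∀ i ∈ τ, 2 ^ (k + n) < (i : ℕ)) :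
    σ ∪ τ ∈ obstructions d := by
  have hσne : σ.Nonempty := Finset.card_pos.1 (by omega)
  refine ⟨hσne.mono Finset.subset_union_left, ?_⟩
  rintro ⟨𝒱, h𝒱, hcover⟩
  have hcard : (σ ∪ τ).card = k + n := by
    rw [Finset.card_union_of_disjoint hστ, hσc, hτc]
  set e : Fin (k + n) ≃ (σ ∪ τ : Finset ℕ+) := ((σ ∪ τ).equivFinOfCardEq hcard).symm with he
  set T : Finset (Fin (k + n)) := Finset.univ.filter fun j => (e j : ℕ+) ∈ τ with hT
  have hTc : T.card = n := by
    refine Eq.trans ?_ hτc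
    refine Finset.card_bij (fun j _ => (e j : ℕ+)) (fun j hj => by simpa [hT] using hj)
      (fun a _ b _ h => e.injective (Subtype.ext h)) fun i hi => ?_
    exact ⟨e.symm ⟨i, Finset.mem_union_right _ hi⟩, by simp [hT, hi], by simp⟩
  set tr : Set X2omega → Set (Fin (k + n) → ℤ) := fun V =>
    {q | ∃ p ∈ V, p.outer = k ∧ p.inner = k + n ∧
      ∀ l : Fin (k + n), p.pad l * 2 = 2 ^ k * (q l : ℝ)} with htr
  have hpow : (1 : ℝ) ≤ 2 ^ k := one_le_pow₀ (by norm_num)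
  have habs : ∀ (p p' : X2omega) (q q' : Fin (k + n) → ℤ) (l : Fin (k + n)),
      p.pad l * 2 = 2 ^ k * (q l : ℝ) → p'.pad l * 2 = 2 ^ k * (q' l : ℝ) →
      2 ^ k * ((|q l - q' l| : ℤ) : ℝ) = 2 * |p.pad l - p'.pad l| := by
    intro p p' q q' l h h'
    push_cast
    rw [← abs_of_pos (show (0 : ℝ) < 2 ^ k by positivity), ← abs_mul, mul_sub, ← h, ← h',
      ← sub_mul, abs_mul, abs_of_pos (show (0 : ℝ) < 2 by norm_num), mul_comm]
  have hsep : ∀ (M : ℕ) (j : Fin (k + n)), 2 ^ k * M < (e j : ℕ) →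
      ∀ W ∈ tr '' 𝒱 (e j), ∀ W' ∈ tr '' 𝒱 (e j), W ≠ W' → ∀ q ∈ W, ∀ q' ∈ W',
        ∃ l, (2 * M : ℤ) < |q l - q' l| := by
    rintro M j hj _ ⟨V, hV, rfl⟩ _ ⟨V', hV', rfl⟩ hne q ⟨p, hp, hpo, hpi, hpq⟩ q'
      ⟨p', hp', hpo', hpi', hpq'⟩
    by_contra! hle
    have h1 := (h𝒱 _ (e j).2).2 V hV V' hV' (fun h => hne (by rw [h])) p hp p' hp'
    have h2 := hd.le_max k p p' hpo.le hpo'.le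
    have h3 : supDist p.vec p'.vec ≤ 2 ^ k * M := by
      refine (supDist_le_iff _ _ (by positivity)).2 fun l => ?_
      change |p.pad l - p'.pad l| ≤ _
      by_cases hl : l < k + n
      · have h4 := habs p p' q q' ⟨l, hl⟩ (hpq _) (hpq' _)
        have h5 : ((|q ⟨l, hl⟩ - q' ⟨l, hl⟩| : ℤ) : ℝ) ≤ 2 * M := by exact_mod_cast hle ⟨l, hl⟩
        simp only at h4
        nlinarith
      · rw [pad_eq_zero (by omega), pad_eq_zero (by omega)]
        simp only [sub_self, abs_zero]
        positivity
    rw [show gap p.inner p'.inner = 0 by rw [hpi, hpi', gap_self],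
      show gap p.outer p'.outer = 0 by rw [hpo, hpo', gap_self], mul_zero, Nat.cast_zero,
      max_eq_left (supDist_nonneg _ _), max_eq_left (supDist_nonneg _ _)] at h2
    have h4 : ((2 ^ k * M : ℕ) : ℝ) < ((e j : ℕ+) : ℕ) := by exact_mod_cast hj
    push_cast at h4
    linarith
  have hbdd : ∀ j, ∃ B : ℤ, ∀ W ∈ tr '' 𝒱 (e j), ∀ q ∈ W, ∀ q' ∈ W, |q j - q' j| ≤ B := by
    intro j
    obtain ⟨C, hC, hbdd⟩ := (h𝒱 _ (e j).2).1
    refine ⟨⌈2 * C⌉, ?_⟩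
    rintro _ ⟨V, hV, rfl⟩ q ⟨p, hp, -, -, hpq⟩ q' ⟨p', hp', -, -, hpq'⟩
    have h1 := habs p p' q q' j (hpq j) (hpq' j)
    have h2 := (abs_pad_sub_pad_le p p' j).trans ((hd.supDist_le p p').trans (hbdd V hV p hp p' hp'))
    have h3 : (0 : ℝ) ≤ ((|q j - q' j| : ℤ) : ℝ) := by exact_mod_cast abs_nonneg _
    have h4 : ((|q j - q' j| : ℤ) : ℝ) ≤ 2 * C := by nlinarith
    exact_mod_cast h4.trans (Int.le_ceil _)
  have hcoarse : ∀ j ∈ T, ∀ W ∈ tr '' 𝒱 (e j), ∀ W' ∈ tr '' 𝒱 (e j), W ≠ W' →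
      ∀ q ∈ W, ∀ q' ∈ W', ∃ l, 2 * 2 ^ n < |q l - q' l| := by
    intro j hj
    have := hsep (2 ^ n) j (by
      rw [← pow_add]
      exact hτ _ (Finset.mem_filter.1 hj).2)
    exact_mod_cast this
  have hfine : ∀ j, j ∉ T → ∀ W ∈ tr '' 𝒱 (e j), ∀ W' ∈ tr '' 𝒱 (e j), W ≠ W' →
      ∀ q ∈ W, ∀ q' ∈ W', ∃ l, 2 < |q l - q' l| := by
    intro j hj
    have hjσ : (e j : ℕ+) ∈ σ := by
      rcases Finset.mem_union.1 (e j).2 with h | h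
      · exact h
      · exact absurd (Finset.mem_filter.2 ⟨Finset.mem_univ j, h⟩) hj
    have := hsep 1 j (by simpa using hσ _ hjσ)
    exact_mod_cast this
  obtain ⟨q, hq1, hq2, hq3⟩ := exists_uncovered_vertex (T := T) (m := 2 * 2 ^ n) (by positivity)
    (even_two_mul _) (fun j => tr '' 𝒱 (e j)) hbdd hcoarse hfine
  rw [hTc, Fintype.card_fin] at hq2
  obtain ⟨p, hpo, hpi, hpq⟩ := exists_point_of_card_offGrid_le hk hq1 (by omega)
  obtain ⟨i, hi, V, hV, hpV⟩ := hcover p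
  refine hq3 (e.symm ⟨i, hi⟩) (tr V) ⟨V, by simpa using hV, rfl⟩ ⟨p, hpV, hpo, hpi, hpq⟩

theorem IsGapDist.trasdimOf_eq (hd : IsGapDist d) (hU : ∀ a : ℕ, ∃ U : Set (Set X2omega),
      UniformlyBdd d U ∧ RDisjoint d a U ∧ ∀ p : X2omega, a ≤ p.outer → ∃ V ∈ U, p ∈ V) :
    trasdimOf d = ((Ordinal.omega0 + Ordinal.omega0 : Ordinal.{0}) : WithTop Ordinal.{0}) := by
  refine borstOrd_eq_omega0_add_omega0 (fun a => ⟨a, fun σ ha hσ => ?_⟩) fun k => ?_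
  · obtain ⟨U, hUb, hUd, hUc⟩ := hU a
    exact hd.residualFamily_card_le hUb hUd hUc ha hσ
  · obtain ⟨σ, hσc, hσ⟩ := exists_finset_pnat_card_eq (2 ^ (k + 1)) (k + 1)
    refine ⟨σ, hσc, fun n => ?_⟩
    obtain ⟨τ, hτc, hτ⟩ := exists_finset_pnat_card_eq
      (max (2 ^ (k + 1 + (n + 1))) (σ.sup fun i => (i : ℕ))) (n + 1)
    have hdisj : Disjoint σ τ := by
      refine Finset.disjoint_left.2 fun i hi hi' => ?_
      have h1 : (i : ℕ) ≤ σ.sup fun i => (i : ℕ) := Finset.le_sup (f := fun i : ℕ+ => (i : ℕ)) hi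
      exact absurd ((le_max_right _ _).trans_lt (hτ i hi')) (not_lt.2 h1)
    refine ⟨τ, ⟨Finset.card_pos.1 (by omega), ?_, Finset.disjoint_iff_inter_eq_empty.1 hdisj⟩,
      by omega⟩
    exact hd.union_mem_obstructions k.succ_pos hdisj hσc hτc hσ fun i hi =>
      (le_max_left _ _).trans_lt (hτ i hi)

end X2omega

theorem theorem1 :
    trasdim X2omega =
        ((Ordinal.omega0 + Ordinal.omega0 : Ordinal.{0}) : WithTop Ordinal.{0}) ∧
      trasdimOf X2omega.weightedDist =
        ((Ordinal.omega0 + Ordinal.omega0 : Ordinal.{0}) : WithTop Ordinal.{0}) :=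
  ⟨X2omega.isGapDist_gapDist.trasdimOf_eq X2omega.exists_family_of_le_outer_gapDist,
    X2omega.isGapDist_weightedDist.trasdimOf_eq X2omega.exists_family_of_le_outer_weightedDist⟩
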